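/- Let $k$ be a field and let $H=\bigoplus_{n\in\mathbb Z}H^n$ be a $\mathbb Z$-graded $k$-algebra which is graded commutative ($ab=(-1)^{|a||b|}ba$ for homogeneous $a,b$), has $H^0=k$, and is generated as a $k$-algebra by finitely many homogeneous elements of positive degree. Let $\mathfrak m$ be the ideal of $H$ generated by the elements of positive degree. Let $M$ be a finitely generated graded $H$-module of Krull dimension $r\ge 0$, and let $d_0,\dots,d_r$ be integers with $d_{i-1}-1\le d_i\le d_{i-1}$ for $1\le i\le r$. Let $\zeta_1,\dots,\zeta_r\in H$ be homogeneous of positive degrees $n_i=|\zeta_i|$ such that $M/(\zeta_1,\dots,\zeta_r)M$ has finite length. For integers $e_0,\dots,e_r$ with $e_{i-1}-1\le e_i\le e_{i-1}$ $(1\le i\le r)$, the sequence is called *filter-regular of type $(e_0,\dots,e_r)$ for $M$* if for each $0\le i\le r-1$ the map $$(M/(\zeta_1,\dots,\zeta_i)M)^j\longrightarrow (M/(\zeta_1,\dots,\zeta_i)M)^{j+n_{i+1}}$$ given by multiplication by $\zeta_{i+1}$ is injective for all $j>n_1+\dots+n_i+e_i$, and $(M/(\zeta_1,\dots,\zeta_r)M)^j=0$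 for all $j>n_1+\dots+n_r+e_r$. It is called *filter-regular for $M$* if it is filter-regular of some type. Let $H^{i,n}_{\mathfrak m}M$ denote the degree $n$ part of the $i$-th local cohomology module of $M$, put $a^i_{\mathfrak m}(M)=\sup\{n\in\mathbb Z\mid H^{i,n}_{\mathfrak m}M\neq 0\}$ (so $a^i_{\mathfrak m}(M)=-\infty$ if $H^i_{\mathfrak m}M=0$), and $\operatorname{Reg}M=\sup_{j\ge 0}\{a^j_{\mathfrak m}(M)+j\}$. **Theorem 4.5.** The following are equivalent: (i) there exists a filter-regular sequence $\zeta_1,\dots,\zeta_r$ of type $(d_0,\dots,d_r)$ for $M$; (ii) every filter-regular sequence $\zeta_1,\dots,\zeta_r$ for $M$ has type $(d_0,\dots,d_r)$; (iii) $a^i_{\mathfrak m}(M)\le d_i$ for $0\le i\le r$. If these equivalent conditions hold, then $$\operatorname{Reg}M\le\max_{0\le i\le r}\{d_i+i\}.$$ -/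

import Mathlib

namespace GradedReg

universe u v w

section Rings

variable {k : Type u} [Field k] {H : Type v} [Ring H] [Algebra k H]

/-- A `ℤ`-graded `k`-algebra `H` is connected and graded commutative: the unit map
`k → H` identifies `k` with `H⁰`, and `ab = (-1)^{|a||b|} ba` for homogeneous `a`, `b`. -/
structure IsConnectedGradedCommutative (𝒜 : ℤ → Submodule k H) : Prop where
  algebraMap_injective : Function.Injective (algebraMap k H)
  degree_zero : ∀ a ∈ 𝒜 0, ∃ c : k, algebraMap k H c = a
  graded_comm : ∀ (i j : ℤ) (a b : H), a ∈ 𝒜 i → b ∈ 𝒜 j →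
    a * b = Int.negOnePow (i * j) • (b * a)

/-- `x₁, …, xₛ` are homogeneous elements of positive degree that generate `H` as a `k`-algebra.
Then they also generate the ideal `𝔪` spanned by all homogeneous elements of positive degree. -/
structure IsHomogeneousGenerators (𝒜 : ℤ → Submodule k H) {s : ℕ} (x : Fin s → H) : Prop where
  homogeneous : ∀ i, ∃ e : ℤ, 0 < e ∧ x i ∈ 𝒜 e
  adjoin_eq_top : Algebra.adjoin k (Set.range x) = ⊤

end Rings

/-- The Krull dimension of an `H`-module `M`: the supremum of the lengths of chains of prime
ideals of `H` containing the annihilator of `M`. (In a graded commutative ring a left ideal that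
is prime in the elementwise sense used here contains the square-zero odd elements, if `2` is
invertible, and hence is two-sided.) It is `⊥` for `M = 0`. -/
noncomputable def krullDim (H : Type v) [Ring H] (M : Type w) [AddCommGroup M] [Module H M] :
    WithBot ℕ∞ :=
  Order.krullDim {P : Ideal H // P.IsPrime ∧ Module.annihilator H M ≤ P}

section LocalCohomology

variable {k : Type u} [Field k] {H : Type v} [Ring H] [Algebra k H]
variable {M : Type w} [AddCommGroup M] [Module H M] {s : ℕ}

/-- The multiplicative set generated by the `x i` with `i ∈ S`, as far as localization is
concerned. It is generated by the squares of the `x i`, which are central when `x i` is a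
homogeneous element of a graded commutative ring, since they have even degree; inverting `x i` or
its square is the same thing. -/
def locSubmonoid (x : Fin s → H) (S : Finset (Fin s)) : Submonoid (Subring.center H) :=
  Submonoid.closure {z | ∃ i ∈ S, (z : H) = x i ^ 2}

theorem locSubmonoid_mono (x : Fin s → H) {S T : Finset (Fin s)} (h : S ⊆ T) :
    locSubmonoid x S ≤ locSubmonoid x T :=
  Submonoid.closure_mono fun _ ⟨i, hi, hz⟩ => ⟨i, h hi, hz⟩

/-- The localization of `M` obtained by inverting the `x i` with `i ∈ S`. -/
abbrev Loc (x : Fin s → H) (M : Type w) [AddCommGroup M] [Module H M] (S : Finset (Fin s)) :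
    Type (max v w) :=
  LocalizedModule (locSubmonoid x S) M

/-- The further localization map `m / u ↦ m / u`. -/
noncomputable def locMap (x : Fin s → H) (M : Type w) [AddCommGroup M] [Module H M]
    {S T : Finset (Fin s)} (h : S ⊆ T) : Loc x M S →ₗ[Subring.center H] Loc x M T :=
  LocalizedModule.liftOfLE (locSubmonoid x S) (locSubmonoid x T) (locSubmonoid_mono x h)

theorem locMap_mk (x : Fin s → H) {S T : Finset (Fin s)} (h : S ⊆ T) (m : M)
    (a : locSubmonoid x S) :
    locMap x M h (LocalizedModule.mk m a) =
      LocalizedModule.mk m ⟨a.1, locSubmonoid_mono x h a.2⟩ := by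
  rw [IsLocalizedModule.mk_eq_mk', IsLocalizedModule.mk_eq_mk']
  exact IsLocalizedModule.liftOfLE_mk' (locSubmonoid x S) (locSubmonoid x T)
    (locSubmonoid_mono x h) (LocalizedModule.mkLinearMap (locSubmonoid x S) M)
    (LocalizedModule.mkLinearMap (locSubmonoid x T) M) m a

theorem locMap_locMap (x : Fin s → H) {R S T : Finset (Fin s)} (h : R ⊆ S) (h' : S ⊆ T)
    (z : Loc x M R) : locMap x M h' (locMap x M h z) = locMap x M (h.trans h') z := by
  induction z using LocalizedModule.induction_on with
  | h m a => simp only [locMap_mk]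

/-- The degree `n` part of a localization: the fractions `m / u` with `u` homogeneous of some
degree `e` and `m` homogeneous of degree `n + e`. -/
def locDegree (𝒜 : ℤ → Submodule k H) [GradedAlgebra 𝒜] (ℳ : ℤ → AddSubgroup M)
    [SetLike.GradedSMul 𝒜 ℳ] (x : Fin s → H) (S : Finset (Fin s)) (n : ℤ) :
    AddSubgroup (Loc x M S) where
  carrier := {z | ∃ (e : ℤ) (m : M) (u : locSubmonoid x S),
    ((u : Subring.center H) : H) ∈ 𝒜 e ∧ m ∈ ℳ (n + e) ∧ z = LocalizedModule.mk m u}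
  zero_mem' := ⟨0, 0, 1, SetLike.GradedOne.one_mem, zero_mem _, (LocalizedModule.zero_mk _).symm⟩
  add_mem' := by
    rintro _ _ ⟨e, m, u, hu, hm, rfl⟩ ⟨e', m', u', hu', hm', rfl⟩
    refine ⟨e + e', u' • m + u • m', u * u', SetLike.GradedMul.mul_mem hu hu', ?_,
      LocalizedModule.mk_add_mk⟩
    have h1 : ((u' : Subring.center H) : H) • m ∈ ℳ (e' +ᵥ (n + e)) :=
      SetLike.GradedSMul.smul_mem hu' hm
    have h2 : ((u : Subring.center H) : H) • m' ∈ ℳ (e +ᵥ (n + e')) :=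
      SetLike.GradedSMul.smul_mem hu hm'
    rw [vadd_eq_add, show e' + (n + e) = n + (e + e') by ring] at h1
    rw [vadd_eq_add, show e + (n + e') = n + (e + e') by ring] at h2
    exact add_mem h1 h2
  neg_mem' := by
    rintro _ ⟨e, m, u, hu, hm, rfl⟩
    exact ⟨e, -m, u, hu, neg_mem hm, LocalizedModule.mk_neg.symm⟩

/-- The differential of the stable Koszul (Čech) complex of `M` with respect to `x`, on all
cohomological and internal degrees at once. A cochain assigns to each set `S` of indices an
element of the localization of `M` at `S`. -/
noncomputable def koszulD (x : Fin s → H) (M : Type w) [AddCommGroup M] [Module H M] :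
    (∀ S, Loc x M S) →+ (∀ S, Loc x M S) where
  toFun c T := ∑ j ∈ T, (-1 : Subring.center H) ^ (T.filter (· < j)).card •
    locMap x M (T.erase_subset j) (c (T.erase j))
  map_zero' := by ext T; simp
  map_add' c c' := by ext T; simp [Finset.sum_add_distrib]

/-- The cochains of cohomological degree `i` and internal degree `n`: the component at `S` is
homogeneous of degree `n`, and it is zero unless `S` has `i` elements. -/
def koszulCochains (𝒜 : ℤ → Submodule k H) [GradedAlgebra 𝒜] (ℳ : ℤ → AddSubgroup M)
    [SetLike.GradedSMul 𝒜 ℳ] (x : Fin s → H) (i n : ℤ) : AddSubgroup (∀ S, Loc x M S) where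
  carrier := {c | ∀ S, c S ∈ locDegree 𝒜 ℳ x S n ∧ ((S.card : ℤ) ≠ i → c S = 0)}
  zero_mem' S := ⟨zero_mem _, fun _ => rfl⟩
  add_mem' h h' S := ⟨add_mem (h S).1 (h' S).1, fun hS => by
    simp [(h S).2 hS, (h' S).2 hS]⟩
  neg_mem' h S := ⟨neg_mem (h S).1, fun hS => by simp [(h S).2 hS]⟩

theorem koszulD_koszulD (x : Fin s → H) (c : ∀ S, Loc x M S) :
    koszulD x M (koszulD x M c) = 0 := by
  have key : ∀ {A B T : Finset (Fin s)} (hA : A ⊆ T) (hB : B ⊆ T), A = B →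
      locMap x M hA (c A) = locMap x M hB (c B) := by
    rintro A _ T hA hB rfl
    rfl
  funext T
  change ∑ j ∈ T, (-1 : Subring.center H) ^ (T.filter (· < j)).card • locMap x M (T.erase_subset j)
    (∑ l ∈ T.erase j, (-1 : Subring.center H) ^ ((T.erase j).filter (· < l)).card •
      locMap x M ((T.erase j).erase_subset l) (c ((T.erase j).erase l))) = 0
  simp only [map_sum, map_smul, Finset.smul_sum, smul_smul, locMap_locMap, ← pow_add]
  rw [Finset.sum_sigma']
  refine Finset.sum_involution (fun p _ => ⟨p.2, p.1⟩) ?_ ?_ ?_ ?_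
  · rintro ⟨j, l⟩ hp
    simp only [Finset.mem_sigma, Finset.mem_erase] at hp
    obtain ⟨hj, hlj, hl⟩ := hp
    have hcount : ∀ {a b : Fin s}, a ∈ T → a < b →
        ((T.erase a).filter (· < b)).card + 1 = (T.filter (· < b)).card ∧
        ((T.erase b).filter (· < a)).card = (T.filter (· < a)).card := by
      intro a b ha hab
      constructor
      · rw [Finset.filter_erase]
        exact Finset.card_erase_add_one (Finset.mem_filter.2 ⟨ha, hab⟩)
      · rw [Finset.filter_erase, Finset.erase_eq_of_notMem]
        simp [hab.le]
    dsimp only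
    rw [key _ (((T.erase_subset _).trans' ((T.erase l).erase_subset j)))
      (Finset.erase_right_comm (a := j) (b := l)), ← add_smul]
    rcases lt_or_gt_of_ne hlj with h | h
    · obtain ⟨h1, h2⟩ := hcount hl h
      rw [h2, ← h1]
      convert zero_smul (Subring.center H) _ using 2
      ring
    · obtain ⟨h1, h2⟩ := hcount hj h
      rw [h2, ← h1]
      convert zero_smul (Subring.center H) _ using 2
      ring
  · rintro ⟨j, l⟩ hp _ h
    simp only [Finset.mem_sigma, Finset.mem_erase] at hp
    simp only [Sigma.mk.injEq] at h
    exact hp.2.1 h.1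
  · rintro ⟨j, l⟩ hp
    simp only [Finset.mem_sigma, Finset.mem_erase] at hp ⊢
    exact ⟨hp.2.2, Ne.symm hp.2.1, hp.1⟩
  · rintro ⟨j, l⟩ hp
    rfl

theorem koszulD_mem (𝒜 : ℤ → Submodule k H) [GradedAlgebra 𝒜] (ℳ : ℤ → AddSubgroup M)
    [SetLike.GradedSMul 𝒜 ℳ] (x : Fin s → H) (i n : ℤ) {c : ∀ S, Loc x M S}
    (hc : c ∈ koszulCochains 𝒜 ℳ x i n) :
    koszulD x M c ∈ koszulCochains 𝒜 ℳ x (i + 1) n := by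
  intro T
  constructor
  · refine sum_mem fun j _ => ?_
    have hsign : ∀ (q : ℕ) (z : Loc x M T), z ∈ locDegree 𝒜 ℳ x T n →
        (-1 : Subring.center H) ^ q • z ∈ locDegree 𝒜 ℳ x T n := by
      intro q z hz
      rcases neg_one_pow_eq_or (Subring.center H) q with h | h
      · rwa [h, one_smul]
      · rw [h, neg_one_smul]
        exact neg_mem hz
    refine hsign _ _ ?_
    obtain ⟨e, m, u, hu, hm, h⟩ := (hc (T.erase j)).1
    exact ⟨e, m, ⟨u.1, locSubmonoid_mono x (T.erase_subset j) u.2⟩, hu, hm, by rw [h, locMap_mk]⟩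
  · intro hT
    refine Finset.sum_eq_zero fun j hj => ?_
    rw [(hc (T.erase j)).2 ?_, map_zero, smul_zero]
    have := Finset.card_erase_add_one hj
    omega

/-- Cocycles of cohomological degree `i` and internal degree `n`. -/
noncomputable def koszulCocycles (𝒜 : ℤ → Submodule k H) [GradedAlgebra 𝒜]
    (ℳ : ℤ → AddSubgroup M) [SetLike.GradedSMul 𝒜 ℳ] (x : Fin s → H) (i n : ℤ) :
    AddSubgroup (∀ S, Loc x M S) :=
  koszulCochains 𝒜 ℳ x i n ⊓ (koszulD x M).ker

/-- Coboundaries of cohomological degree `i` and internal degree `n`. -/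
noncomputable def koszulCoboundaries (𝒜 : ℤ → Submodule k H) [GradedAlgebra 𝒜]
    (ℳ : ℤ → AddSubgroup M) [SetLike.GradedSMul 𝒜 ℳ] (x : Fin s → H) (i n : ℤ) :
    AddSubgroup (∀ S, Loc x M S) :=
  (koszulCochains 𝒜 ℳ x (i - 1) n).map (koszulD x M)

theorem koszulCoboundaries_le_cocycles (𝒜 : ℤ → Submodule k H) [GradedAlgebra 𝒜]
    (ℳ : ℤ → AddSubgroup M) [SetLike.GradedSMul 𝒜 ℳ] (x : Fin s → H) (i n : ℤ) :
    koszulCoboundaries 𝒜 ℳ x i n ≤ koszulCocycles 𝒜 ℳ x i n := by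
  rintro _ ⟨c, hc, rfl⟩
  refine ⟨by simpa using koszulD_mem 𝒜 ℳ x (i - 1) n hc, ?_⟩
  exact koszulD_koszulD x c

/-- The degree `n` part of the `i`-th local cohomology of the graded module `M` with respect to the
ideal generated by `x`: the cohomology of the stable Koszul complex. -/
abbrev LocalCohomology (𝒜 : ℤ → Submodule k H) [GradedAlgebra 𝒜] (ℳ : ℤ → AddSubgroup M)
    [SetLike.GradedSMul 𝒜 ℳ] (x : Fin s → H) (i : ℕ) (n : ℤ) : Type (max v w) :=
  koszulCocycles 𝒜 ℳ x i n ⧸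
    (koszulCoboundaries 𝒜 ℳ x i n).addSubgroupOf (koszulCocycles 𝒜 ℳ x i n)

/-- `aⁱ(M)`, the largest degree in which the `i`-th local cohomology does not vanish; it is `-∞`
if there is no such degree (and `+∞` if these degrees are unbounded above). -/
noncomputable def aInvariant (𝒜 : ℤ → Submodule k H) [GradedAlgebra 𝒜] (ℳ : ℤ → AddSubgroup M)
    [SetLike.GradedSMul 𝒜 ℳ] (x : Fin s → H) (i : ℕ) : WithBot (WithTop ℤ) :=
  sSup {a | ∃ n : ℤ, Nontrivial (LocalCohomology 𝒜 ℳ x i n) ∧ a = ((n : WithTop ℤ) : _)}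

/-- Castelnuovo–Mumford regularity, `max_{j ≥ 0} (aʲ(M) + j)`. -/
noncomputable def regularity (𝒜 : ℤ → Submodule k H) [GradedAlgebra 𝒜] (ℳ : ℤ → AddSubgroup M)
    [SetLike.GradedSMul 𝒜 ℳ] (x : Fin s → H) : WithBot (WithTop ℤ) :=
  ⨆ j : ℕ, (aInvariant 𝒜 ℳ x j + (((j : ℤ) : WithTop ℤ) : WithBot (WithTop ℤ)))

end LocalCohomology

section FilterRegular

variable {k : Type u} [Field k] {H : Type v} [Ring H] [Algebra k H]
variable {M : Type w} [AddCommGroup M] [Module H M] {r : ℕ}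

/-- The conditions `d_{i-1} - 1 ≤ d_i ≤ d_{i-1}` for `1 ≤ i ≤ r`. -/
def IsTypeSequence (d : Fin (r + 1) → ℤ) : Prop :=
  ∀ i : Fin r, d i.castSucc - 1 ≤ d i.succ ∧ d i.succ ≤ d i.castSucc

/-- The submodule `(ζ₁, …, ζᵢ)M` of `M`. -/
def prefixSubmodule (M : Type w) [AddCommGroup M] [Module H M] (ζ : Fin r → H) (i : ℕ) :
    Submodule H M :=
  Submodule.span H {y | ∃ (j : Fin r) (m : M), (j : ℕ) < i ∧ y = ζ j • m}

/-- The sum `n₁ + … + nᵢ`. -/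
def prefixSum (n : Fin r → ℤ) (i : ℕ) : ℤ :=
  ∑ j ∈ Finset.univ.filter (fun j : Fin r => (j : ℕ) < i), n j

/-- `ζ₁, …, ζᵣ` is a homogeneous system of parameters for `M`, with `|ζᵢ| = nᵢ > 0`. (It is used
for `M` of Krull dimension `r`.) -/
structure IsHSOP (𝒜 : ℤ → Submodule k H) (M : Type w) [AddCommGroup M] [Module H M]
    (ζ : Fin r → H) (n : Fin r → ℤ) : Prop where
  pos : ∀ i, 0 < n i
  homogeneous : ∀ i, ζ i ∈ 𝒜 (n i)
  finite_length : IsFiniteLength H (M ⧸ prefixSubmodule M ζ r)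

/-- `ζ₁, …, ζᵣ` is a filter-regular system of parameters of type `(d₀, …, dᵣ)` for `M`:
multiplication by `ζᵢ₊₁` on `M/(ζ₁, …, ζᵢ)M` is injective in degrees `> n₁ + … + nᵢ + dᵢ` for
`0 ≤ i < r`, and `M/(ζ₁, …, ζᵣ)M` vanishes in degrees `> n₁ + … + nᵣ + dᵣ`. Elements of degree `j`
of the quotients are represented by elements of degree `j` of `M`. -/
structure IsFilterRegularOfType (𝒜 : ℤ → Submodule k H) (ℳ : ℤ → AddSubgroup M)
    (ζ : Fin r → H) (n : Fin r → ℤ) (d : Fin (r + 1) → ℤ) : Prop where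
  hsop : IsHSOP 𝒜 M ζ n
  injective : ∀ (i : Fin r) (j : ℤ), prefixSum n i + d i.castSucc < j →
    ∀ m ∈ ℳ j, ζ i • m ∈ prefixSubmodule M ζ i → m ∈ prefixSubmodule M ζ i
  vanishing : ∀ j : ℤ, prefixSum n r + d (Fin.last r) < j →
    ∀ m ∈ ℳ j, m ∈ prefixSubmodule M ζ r

/-- `ζ₁, …, ζᵣ` is filter-regular for `M`: it is so of some type. -/
def IsFilterRegular (𝒜 : ℤ → Submodule k H) (ℳ : ℤ → AddSubgroup M)
    (ζ : Fin r → H) (n : Fin r → ℤ) : Prop :=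
  ∃ d : Fin (r + 1) → ℤ, IsTypeSequence d ∧ IsFilterRegularOfType 𝒜 ℳ ζ n d

end FilterRegular

end GradedReg

/-!
The statement is proved by induction along a filter-regular sequence, comparing `M` with `M / ζ₁M`.

Multiplication by a homogeneous `ζ` of degree `n` on `M` is linear over the center of `H`, so it
acts on the stable Koszul complex. If its kernel is bounded above, the kernel dies in every
localization at a nonempty set of generators; hence, apart from cohomological degree `0`, the
complexes of `M`, `M` and `M / ζM` form a short exact sequence, and a diagram chase gives the
exactness of
`Hⁱ⁻¹(M/ζM)_{j+n} → Hⁱ(M)_j → Hⁱ(M)_{j+n}` for `i ≥ 1` (`mem_coboundaries_of_smulHom_mem`) and of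
`Hⁱ(M)_{j+n} → Hⁱ(M/ζM)_{j+n} → Hⁱ⁺¹(M)_j` (`vanishes_quotient`).

* If the sequence has type `d`, then by induction `ζ₁` is injective on `Hⁱ(M)` in degrees `> dᵢ`.
  Every class is killed by a power of `ζ₁` (`exists_smulHom_mem_coboundaries`, which rests on the
  contractibility of the stable Koszul complex after inverting a generator), so `Hⁱ(M)` vanishes in
  these degrees. The same argument shows `Hⁱ(M) = 0` for `i > r`, which is what the bound for the
  regularity needs (`IsRegularOfType.vanishes`).
* Conversely, if `Hⁱ(M)` vanishes in degrees `> dᵢ`, then so does the kernel of `ζ₁` in degrees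
  `> d₀`, being contained in `H⁰(M)`; and `Hⁱ(M/ζ₁M)` vanishes in degrees `> n₁ + dᵢ₊₁`, because
  `dᵢ ≤ dᵢ₊₁ + 1 ≤ dᵢ₊₁ + n₁` (`IsRegularOfType.of_vanishes`).

It remains to see that filter-regular sequences of length `r` exist. Regard `M` as a finitely
generated module over the polynomial ring `R` whose variables act as the squares of the generators
of `H`, which are central. Homogeneous prime avoidance gives an element outside all associated primes
that do not contain all variables; its kernel is bounded above, and it lowers the dimension
(`exists_hasBoundedKernel_of_relevant`). The dimension of `M` over `R` is at most the Krull
dimension `r` over `H`, by going up from `R` to the largest commutative quotient of `H / ann M`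
(`supportDim_le_krullDim`).
-/

namespace GradedReg

universe u v w w'

/-! ### Graded modules over graded commutative rings -/

section Basics

variable {k : Type u} [Field k] {H : Type v} [Ring H] [Algebra k H]
variable {𝒜 : ℤ → Submodule k H}

open DirectSum

theorem smul_mem_degree {M : Type w} [AddCommGroup M] [Module H M] {ℳ : ℤ → AddSubgroup M}
    [SetLike.GradedSMul 𝒜 ℳ] {p j q : ℤ} {a : H} {m : M} (ha : a ∈ 𝒜 p) (hm : m ∈ ℳ j)
    (hq : q = p + j) : a • m ∈ ℳ q := by
  subst hq
  exact SetLike.GradedSMul.smul_mem ha hm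

theorem coe_decompose_smul {M : Type w} [AddCommGroup M] [Module H M] {ℳ : ℤ → AddSubgroup M}
    [DirectSum.Decomposition ℳ] [SetLike.GradedSMul 𝒜 ℳ] {p : ℤ} {a : H} (ha : a ∈ 𝒜 p)
    (m : M) (j q : ℤ) (hq : q = p + j) :
    (decompose ℳ (a • m) q : M) = a • (decompose ℳ m j : M) := by
  induction m using DirectSum.Decomposition.inductionOn ℳ with
  | zero => simp
  | @homogeneous i m =>
    have h : a • (m : M) ∈ ℳ (p + i) := smul_mem_degree ha m.2 rfl
    rcases eq_or_ne i j with rfl | hij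
    · subst hq
      rw [decompose_of_mem_same _ h, decompose_of_mem_same _ m.2]
    · rw [decompose_of_mem_ne _ h (by omega), decompose_of_mem_ne _ m.2 hij, smul_zero]
  | add m m' h h' => simp [smul_add, h, h']

variable [GradedAlgebra 𝒜]

theorem IsConnectedGradedCommutative.exists_mul_eq_mul (hH : IsConnectedGradedCommutative 𝒜)
    {i : ℤ} {a : H} (ha : a ∈ 𝒜 i) (h : H) : ∃ h', h * a = a * h' := by
  induction h using DirectSum.Decomposition.inductionOn 𝒜 with
  | zero => exact ⟨0, by simp⟩
  | @homogeneous j m =>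
    refine ⟨Int.negOnePow (j * i) • (m : H), ?_⟩
    rw [hH.graded_comm j i _ a m.2 ha, mul_smul_comm]
  | add m m' h h' =>
    obtain ⟨b, hb⟩ := h
    obtain ⟨b', hb'⟩ := h'
    exact ⟨b + b', by rw [add_mul, hb, hb', mul_add]⟩

theorem IsConnectedGradedCommutative.mem_center_of_even (hH : IsConnectedGradedCommutative 𝒜)
    {i : ℤ} (hi : Even i) {a : H} (ha : a ∈ 𝒜 i) : a ∈ Subring.center H := by
  rw [Subring.mem_center_iff]
  intro h
  induction h using DirectSum.Decomposition.inductionOn 𝒜 with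
  | zero => simp
  | @homogeneous j m =>
    rw [hH.graded_comm j i _ a m.2 ha, Int.negOnePow_even _ (hi.mul_left j), one_smul]
  | add m m' h h' => rw [add_mul, h, h', mul_add]

theorem sq_mem_center (hH : IsConnectedGradedCommutative 𝒜) {i : ℤ} {a : H} (ha : a ∈ 𝒜 i) :
    a ^ 2 ∈ Subring.center H := by
  refine hH.mem_center_of_even (i := i + i) ⟨i, rfl⟩ ?_
  rw [pow_two]
  exact SetLike.GradedMul.mul_mem ha ha

/-! ### Words in the generators -/

variable {s : ℕ} {x : Fin s → H}

theorem word_mem_degree {e : Fin s → ℤ} (he : ∀ l, x l ∈ 𝒜 (e l)) (L : List (Fin s)) :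
    (L.map x).prod ∈ 𝒜 (L.map e).sum := by
  induction L with
  | nil => simpa using SetLike.GradedOne.one_mem
  | cons l L ih => simpa using SetLike.GradedMul.mul_mem (he l) ih

theorem mem_span_word_range (hx : Algebra.adjoin k (Set.range x) = ⊤) (a : H) :
    a ∈ Submodule.span k (Set.range fun L : List (Fin s) => (L.map x).prod) := by
  have h : a ∈ Submodule.span k (Submonoid.closure (Set.range x) : Set H) := by
    rw [← Algebra.adjoin_eq_span, hx]
    trivial
  refine Submodule.span_mono ?_ h
  intro b hb
  induction hb using Submonoid.closure_induction with
  | mem b hb =>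
    obtain ⟨l, rfl⟩ := hb
    exact ⟨[l], by simp⟩
  | one => exact ⟨[], by simp⟩
  | mul b c _ _ hb hc =>
    obtain ⟨L, rfl⟩ := hb
    obtain ⟨L', rfl⟩ := hc
    exact ⟨L ++ L', by simp⟩

/-- A homogeneous element is a linear combination of words of the same degree in homogeneous
generators. -/
theorem mem_span_words (hx : Algebra.adjoin k (Set.range x) = ⊤) {e : Fin s → ℤ}
    (he : ∀ l, x l ∈ 𝒜 (e l)) {D : ℤ} {a : H} (ha : a ∈ 𝒜 D) :
    a ∈ Submodule.span k {b | ∃ L : List (Fin s), (L.map e).sum = D ∧ b = (L.map x).prod} := by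
  have key : ∀ a : H, (decompose 𝒜 a D : H) ∈
      Submodule.span k {b | ∃ L : List (Fin s), (L.map e).sum = D ∧ b = (L.map x).prod} := by
    intro a
    have h := mem_span_word_range hx a
    induction h using Submodule.span_induction with
    | mem b hb =>
      obtain ⟨L, rfl⟩ := hb
      by_cases hL : (L.map e).sum = D
      · have := word_mem_degree he L
        rw [hL] at this
        simp only [decompose_of_mem_same _ this]
        exact Submodule.subset_span ⟨L, hL, rfl⟩
      · simp only [decompose_of_mem_ne _ (word_mem_degree he L) hL]
        exact zero_mem _
    | zero => simp
    | add b c _ _ hb hc =>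
      rw [decompose_add, DirectSum.add_apply, Submodule.coe_add]
      exact add_mem hb hc
    | smul c b _ hb =>
      rw [decompose_smul]
      exact Submodule.smul_mem _ c hb
  rw [← decompose_of_mem_same 𝒜 ha]
  exact key a

/-- The occurrences of a generator in a word can be moved to the right, at the cost of a sign. -/
theorem exists_word_eq_mul_pow (hH : IsConnectedGradedCommutative 𝒜) {e : Fin s → ℤ}
    (he : ∀ l, x l ∈ 𝒜 (e l)) (l : Fin s) (L : List (Fin s)) :
    ∃ h, (L.map x).prod = h * x l ^ L.count l := by
  induction L using List.reverseRecOn with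
  | nil => exact ⟨1, by simp⟩
  | append_singleton L j ih =>
    obtain ⟨h, hh⟩ := ih
    by_cases hj : j = l
    · subst hj
      exact ⟨h, by simp [hh, pow_succ, mul_assoc]⟩
    · have hp : x l ^ L.count l ∈ 𝒜 (L.count l • e l) := SetLike.pow_mem_graded _ (he l)
      refine ⟨Int.negOnePow (L.count l • e l * e j) • (h * x j), ?_⟩
      have hc : (L ++ [j]).count l = L.count l := by
        simp [hj]
      rw [List.map_append, List.prod_append, hh, hc]
      simp only [List.map_cons, List.map_nil, List.prod_cons, List.prod_nil, mul_one]
      rw [mul_assoc, hH.graded_comm _ _ _ _ hp (he j), mul_smul_comm, ← mul_assoc h]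
      exact (smul_mul_assoc _ _ _).symm

theorem exists_le_count (L : List (Fin s)) (N : ℕ) (hL : s * N < L.length) :
    ∃ l, N ≤ L.count l := by
  by_contra! h
  have h1 : L.length = ∑ l : Fin s, L.count l := by
    have := Multiset.sum_count_eq_card (s := (Finset.univ : Finset (Fin s))) (m := (L : Multiset _))
      (by simp)
    simpa using this.symm
  have h2 : ∑ l : Fin s, L.count l ≤ ∑ _l : Fin s, N := Finset.sum_le_sum fun l _ => (h l).le
  simp at h2
  omega

/-- Homogeneous elements of large degree lie in the ideal generated by prescribed powers of the
squares of the generators: in a long word some generator occurs often. -/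
theorem exists_eq_sum_mul_sq_pow (hH : IsConnectedGradedCommutative 𝒜)
    (hx : Algebra.adjoin k (Set.range x) = ⊤) {e : Fin s → ℤ} (he : ∀ l, x l ∈ 𝒜 (e l)) (N : ℕ) :
    ∃ D₀ : ℤ, ∀ D, D₀ ≤ D → ∀ a ∈ 𝒜 D, ∃ h : Fin s → H,
      (∀ l, h l ∈ 𝒜 (D - N * (2 * e l))) ∧ a = ∑ l, h l * (x l ^ 2) ^ N := by
  obtain ⟨E, hE0, hE⟩ : ∃ E : ℤ, 0 ≤ E ∧ ∀ l, e l ≤ E :=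
    ⟨∑ l, |e l|, Finset.sum_nonneg fun l _ => abs_nonneg _, fun l => (le_abs_self _).trans
      (Finset.single_le_sum (f := fun l => |e l|) (fun l _ => abs_nonneg _) (Finset.mem_univ l))⟩
  have hsum : ∀ L : List (Fin s), (L.map e).sum ≤ L.length * E := by
    intro L
    induction L with
    | nil => simp
    | cons l L ih =>
      simp only [List.map_cons, List.sum_cons, List.length_cons]
      push_cast
      linarith [hE l]
  refine ⟨(s * (2 * N) : ℕ) * E + 1, fun D hD a ha => ?_⟩
  have h1 : a ∈ Ideal.span (Set.range fun l => (x l ^ 2) ^ N) := by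
    have h2 := mem_span_words hx he ha
    have h3 : Submodule.span k {b | ∃ L : List (Fin s), (L.map e).sum = D ∧ b = (L.map x).prod} ≤
        (Ideal.span (Set.range fun l => (x l ^ 2) ^ N)).restrictScalars k := by
      rw [Submodule.span_le]
      rintro _ ⟨L, hL, rfl⟩
      have hlen : s * (2 * N) < L.length := by
        by_contra! hlen
        have := hsum L
        have h4 : (L.length : ℤ) * E ≤ (s * (2 * N) : ℕ) * E :=
          mul_le_mul_of_nonneg_right (by exact_mod_cast hlen) hE0
        omega
      obtain ⟨l, hl⟩ := exists_le_count L (2 * N) hlen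
      obtain ⟨h, hh⟩ := exists_word_eq_mul_pow hH he l L
      simp only [Submodule.coe_restrictScalars, SetLike.mem_coe]
      rw [hh, ← Nat.sub_add_cancel hl, pow_add, ← mul_assoc, pow_mul]
      exact Ideal.mul_mem_left _ _ (Ideal.subset_span ⟨l, rfl⟩)
    exact h3 h2
  obtain ⟨h, hh⟩ := (Ideal.mem_span_range_iff_exists_fun).1 h1
  refine ⟨fun l => (decompose 𝒜 (h l) (D - N * (2 * e l)) : H), fun l => SetLike.coe_mem _, ?_⟩
  rw [← decompose_of_mem_same 𝒜 ha, ← hh, decompose_sum, DFinsupp.finsetSum_apply,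
    AddSubmonoidClass.coe_finsetSum]
  refine Finset.sum_congr rfl fun l _ => ?_
  have hp : (x l ^ 2) ^ N ∈ 𝒜 (N * (2 * e l)) := by
    have := SetLike.pow_mem_graded N (SetLike.pow_mem_graded 2 (he l))
    simpa using this
  conv_lhs => rw [← sub_add_cancel D (N * (2 * e l))]
  exact coe_decompose_mul_add_of_right_mem 𝒜 hp

/-! ### Quotients of graded modules -/

variable {M : Type w} [AddCommGroup M] [Module H M]

/-- The submodule `aM` of `M`. It is written as a span since multiplication by `a` is not
`H`-linear in general. -/
def mulSubmodule (M : Type w) [AddCommGroup M] [Module H M] (a : H) : Submodule H M :=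
  Submodule.span H {y | ∃ m : M, y = a • m}

theorem mem_mulSubmodule (hH : IsConnectedGradedCommutative 𝒜) {i : ℤ} {a : H} (ha : a ∈ 𝒜 i)
    {y : M} : y ∈ mulSubmodule M a ↔ ∃ m, y = a • m := by
  refine ⟨fun h => ?_, fun h => Submodule.subset_span h⟩
  induction h using Submodule.span_induction with
  | mem y hy => exact hy
  | zero => exact ⟨0, by simp⟩
  | add y z _ _ hy hz =>
    obtain ⟨m, rfl⟩ := hy
    obtain ⟨m', rfl⟩ := hz
    exact ⟨m + m', by simp⟩
  | smul h y _ hy =>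
    obtain ⟨m, rfl⟩ := hy
    obtain ⟨h', hh⟩ := hH.exists_mul_eq_mul ha h
    exact ⟨h' • m, by rw [smul_smul, hh, mul_smul]⟩

/-- The grading on a quotient `M / N`: the image of the grading of `M`. The submodule `N` is not
required to be homogeneous here. -/
def quotientGrading (ℳ : ℤ → AddSubgroup M) (N : Submodule H M) (j : ℤ) : AddSubgroup (M ⧸ N) :=
  (ℳ j).map N.mkQ.toAddMonoidHom

instance quotientGrading_gradedSMul (ℳ : ℤ → AddSubgroup M) [SetLike.GradedSMul 𝒜 ℳ]
    (N : Submodule H M) : SetLike.GradedSMul 𝒜 (quotientGrading ℳ N) where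
  smul_mem := by
    rintro i j a _ ha ⟨m, hm, rfl⟩
    exact ⟨a • m, SetLike.GradedSMul.smul_mem ha hm, map_smul N.mkQ a m⟩

/-- The quotient by a homogeneous submodule is graded. -/
theorem quotientGrading_isInternal (ℳ : ℤ → AddSubgroup M) [DirectSum.Decomposition ℳ]
    (N : Submodule H M) (hN : ∀ m ∈ N, ∀ j, (decompose ℳ m j : M) ∈ N) :
    DirectSum.IsInternal (quotientGrading ℳ N) := by
  constructor
  · rw [injective_iff_map_eq_zero]
    intro f hf
    let π : ∀ j, ℳ j →+ quotientGrading ℳ N j := fun j =>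
      N.mkQ.toAddMonoidHom.addSubgroupMap (ℳ j)
    obtain ⟨G, rfl⟩ := (DirectSum.map_surjective (f := π)).2
      (fun j => N.mkQ.toAddMonoidHom.addSubgroupMap_surjective (ℳ j)) f
    have h1 : (DirectSum.coeAddMonoidHom (quotientGrading ℳ N)).comp (DirectSum.map π) =
        N.mkQ.toAddMonoidHom.comp (DirectSum.coeAddMonoidHom ℳ) := by
      ext j m
      simp only [AddMonoidHom.comp_apply, DirectSum.map_of, DirectSum.coeAddMonoidHom_of]
      rfl
    have h2 : DirectSum.coeAddMonoidHom ℳ G ∈ N := by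
      have := DFunLike.congr_fun h1 G
      rw [AddMonoidHom.comp_apply, hf] at this
      simpa using this.symm
    ext j
    have h3 := hN _ h2 j
    have h4 : decompose ℳ (DirectSum.coeAddMonoidHom ℳ G) = G := Decomposition.right_inv G
    rw [h4] at h3
    rw [DirectSum.map_apply]
    exact (Submodule.Quotient.mk_eq_zero N).2 h3
  · intro q
    obtain ⟨m, rfl⟩ := N.mkQ_surjective q
    induction m using DirectSum.Decomposition.inductionOn ℳ with
    | zero => exact ⟨0, by simp⟩
    | @homogeneous i m =>
      exact ⟨DirectSum.of _ i ⟨N.mkQ m, m, m.2, rfl⟩, DirectSum.coeAddMonoidHom_of _ _ _⟩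
    | add m m' h h' =>
      obtain ⟨f, hf⟩ := h
      obtain ⟨f', hf'⟩ := h'
      exact ⟨f + f', by rw [map_add, hf, hf', map_add]⟩

theorem decompose_mem_mulSubmodule (hH : IsConnectedGradedCommutative 𝒜) {ℳ : ℤ → AddSubgroup M}
    [DirectSum.Decomposition ℳ] [SetLike.GradedSMul 𝒜 ℳ] {i : ℤ} {a : H} (ha : a ∈ 𝒜 i) :
    ∀ m ∈ mulSubmodule M a, ∀ j, (decompose ℳ m j : M) ∈ mulSubmodule M a := by
  intro m hm j
  obtain ⟨m', rfl⟩ := (mem_mulSubmodule hH ha).1 hm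
  exact (mem_mulSubmodule hH ha).2 ⟨_, coe_decompose_smul ha m' (j - i) j (by ring)⟩

theorem exists_homogeneous_of_mem_mulSubmodule (hH : IsConnectedGradedCommutative 𝒜)
    {ℳ : ℤ → AddSubgroup M} [DirectSum.Decomposition ℳ] [SetLike.GradedSMul 𝒜 ℳ] {i j : ℤ} {a : H}
    (ha : a ∈ 𝒜 i) {y : M} (hy : y ∈ mulSubmodule M a) (hj : y ∈ ℳ (j + i)) :
    ∃ m ∈ ℳ j, y = a • m := by
  obtain ⟨m', rfl⟩ := (mem_mulSubmodule hH ha).1 hy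
  refine ⟨_, SetLike.coe_mem (decompose ℳ m' j), ?_⟩
  rw [← coe_decompose_smul ha m' j (j + i) (by ring), decompose_of_mem_same _ hj]

end Basics

/-! ### Functoriality of the stable Koszul complex -/

section Functoriality

variable {k : Type u} [Field k] {H : Type v} [Ring H] [Algebra k H]
variable {M : Type w} [AddCommGroup M] [Module H M] {M' : Type w'} [AddCommGroup M'] [Module H M']
variable {s : ℕ} {x : Fin s → H}

/-- Multiplication by an element of `H`, as a map linear over the center of `H`. -/
def smulHom (M : Type w) [AddCommGroup M] [Module H M] (a : H) : M →ₗ[Subring.center H] M where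
  toFun m := a • m
  map_add' := smul_add a
  map_smul' z m := by
    change a • ((z : H) • m) = (z : H) • (a • m)
    rw [smul_smul, smul_smul, Subring.mem_center_iff.1 z.2 a]

@[simp]
theorem smulHom_apply (a : H) (m : M) : smulHom M a m = a • m :=
  rfl

/-- A quotient map of `H`-modules, as a map linear over the center of `H`. -/
def centerMkQ (N : Submodule H M) : M →ₗ[Subring.center H] M ⧸ N where
  toFun m := N.mkQ m
  map_add' := map_add N.mkQ
  map_smul' z m := map_smul N.mkQ (z : H) m

/-- The map on localizations induced by a map of modules over the center. -/
noncomputable def locFunctor (x : Fin s → H) (φ : M →ₗ[Subring.center H] M') (S : Finset (Fin s)) :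
    Loc x M S →ₗ[Subring.center H] Loc x M' S :=
  IsLocalizedModule.map (locSubmonoid x S) (LocalizedModule.mkLinearMap (locSubmonoid x S) M)
    (LocalizedModule.mkLinearMap (locSubmonoid x S) M') φ

@[simp]
theorem locFunctor_mk (φ : M →ₗ[Subring.center H] M') {S : Finset (Fin s)} (m : M)
    (u : locSubmonoid x S) :
    locFunctor x φ S (LocalizedModule.mk m u) = LocalizedModule.mk (φ m) u :=
  IsLocalizedModule.map_LocalizedModules _ φ m u

theorem mk_eq_zero_iff {S : Finset (Fin s)} (m : M) (u : locSubmonoid x S) :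
    (LocalizedModule.mk m u : Loc x M S) = 0 ↔ ∃ v ∈ locSubmonoid x S, (v : H) • m = 0 := by
  rw [← LocalizedModule.zero_mk u, LocalizedModule.mk_eq]
  simp only [smul_zero]
  constructor
  · rintro ⟨v, hv⟩
    refine ⟨v * u, mul_mem v.2 u.2, ?_⟩
    rw [← hv, smul_smul]
    rfl
  · rintro ⟨v, hv, h⟩
    refine ⟨⟨v, hv⟩, ?_⟩
    change (v : H) • ((u : Subring.center H) : H) • m = 0
    rw [smul_smul, ← Subring.mem_center_iff.1 v.2, mul_smul, h, smul_zero]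

/-- The map on stable Koszul complexes induced by a map of modules over the center. -/
noncomputable def cochainMap (x : Fin s → H) (φ : M →ₗ[Subring.center H] M') :
    (∀ S, Loc x M S) →ₗ[Subring.center H] (∀ S, Loc x M' S) :=
  LinearMap.piMap fun S => locFunctor x φ S

theorem cochainMap_apply (φ : M →ₗ[Subring.center H] M') (c : ∀ S, Loc x M S)
    (S : Finset (Fin s)) : cochainMap x φ c S = locFunctor x φ S (c S) :=
  rfl

theorem koszulD_apply (c : ∀ S, Loc x M S) (T : Finset (Fin s)) :
    koszulD x M c T = ∑ j ∈ T, (-1 : Subring.center H) ^ (T.filter (· < j)).card •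
      locMap x M (T.erase_subset j) (c (T.erase j)) :=
  rfl

theorem locFunctor_locMap (φ : M →ₗ[Subring.center H] M') {S T : Finset (Fin s)} (h : S ⊆ T)
    (z : Loc x M S) :
    locFunctor x φ T (locMap x M h z) = locMap x M' h (locFunctor x φ S z) := by
  induction z using LocalizedModule.induction_on with
  | h m a => simp only [locMap_mk, locFunctor_mk]

theorem cochainMap_koszulD (φ : M →ₗ[Subring.center H] M') (c : ∀ S, Loc x M S) :
    cochainMap x φ (koszulD x M c) = koszulD x M' (cochainMap x φ c) := by
  funext T
  simp only [cochainMap_apply, koszulD_apply, map_sum, map_smul, locFunctor_locMap]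

theorem koszulD_smul (z : Subring.center H) (c : ∀ S, Loc x M S) :
    koszulD x M (z • c) = z • koszulD x M c := by
  funext T
  simp only [Pi.smul_apply, koszulD_apply, map_smul, Finset.smul_sum]
  refine Finset.sum_congr rfl fun j _ => smul_comm _ _ _

theorem cochainMap_smulHom_center (z : Subring.center H) (c : ∀ S, Loc x M S) :
    cochainMap x (smulHom M (z : H)) c = z • c := by
  funext S
  rw [cochainMap_apply, Pi.smul_apply]
  induction c S using LocalizedModule.induction_on with
  | h m a =>
    rw [locFunctor_mk, LocalizedModule.smul'_mk]
    rfl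

theorem cochainMap_comp {M'' : Type*} [AddCommGroup M''] [Module H M'']
    (ψ : M' →ₗ[Subring.center H] M'') (φ : M →ₗ[Subring.center H] M') (c : ∀ S, Loc x M S) :
    cochainMap x ψ (cochainMap x φ c) = cochainMap x (ψ.comp φ) c := by
  funext S
  simp only [cochainMap_apply]
  induction c S using LocalizedModule.induction_on with
  | h m a => simp

theorem cochainMap_sum {ι : Type*} (t : Finset ι) (φ : ι → M →ₗ[Subring.center H] M')
    (c : ∀ S, Loc x M S) :
    cochainMap x (∑ i ∈ t, φ i) c = ∑ i ∈ t, cochainMap x (φ i) c := by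
  funext S
  rw [Finset.sum_apply]
  simp only [cochainMap_apply, locFunctor, map_sum, LinearMap.sum_apply]

theorem cochainMap_zero (c : ∀ S, Loc x M S) :
    cochainMap x (0 : M →ₗ[Subring.center H] M') c = 0 := by
  funext S
  simp [cochainMap_apply, locFunctor]

end Functoriality

section Cochains

variable {k : Type u} [Field k] {H : Type v} [Ring H] [Algebra k H]
variable {𝒜 : ℤ → Submodule k H} [GradedAlgebra 𝒜]
variable {M : Type w} [AddCommGroup M] [Module H M] {ℳ : ℤ → AddSubgroup M}
  [SetLike.GradedSMul 𝒜 ℳ]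
variable {M' : Type w'} [AddCommGroup M'] [Module H M'] {ℳ' : ℤ → AddSubgroup M'}
  [SetLike.GradedSMul 𝒜 ℳ']
variable {s : ℕ} {x : Fin s → H}

theorem cochainMap_mem {φ : M →ₗ[Subring.center H] M'} {δ : ℤ}
    (hφ : ∀ j, ∀ m ∈ ℳ j, φ m ∈ ℳ' (j + δ)) {i n p : ℤ} (hp : p = n + δ) {c : ∀ S, Loc x M S}
    (hc : c ∈ koszulCochains 𝒜 ℳ x i n) :
    cochainMap x φ c ∈ koszulCochains 𝒜 ℳ' x i p := by
  subst hp
  intro S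
  constructor
  · obtain ⟨e, m, u, hu, hm, h⟩ := (hc S).1
    refine ⟨e, φ m, u, hu, ?_, by rw [cochainMap_apply, h, locFunctor_mk]⟩
    have := hφ _ m hm
    rwa [add_right_comm] at this
  · intro hS
    rw [cochainMap_apply, (hc S).2 hS, map_zero]

theorem cochainMap_smulHom_mem {a : H} {δ : ℤ} (ha : a ∈ 𝒜 δ) {i n p : ℤ} (hp : p = n + δ)
    {c : ∀ S, Loc x M S} (hc : c ∈ koszulCochains 𝒜 ℳ x i n) :
    cochainMap x (smulHom M a) c ∈ koszulCochains 𝒜 ℳ x i p :=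
  cochainMap_mem (fun j _ hm => smul_mem_degree ha hm (add_comm j δ)) hp hc

theorem mem_coboundaries {i n : ℤ} {c : ∀ S, Loc x M S} :
    c ∈ koszulCoboundaries 𝒜 ℳ x i n ↔ ∃ b ∈ koszulCochains 𝒜 ℳ x (i - 1) n, koszulD x M b = c :=
  Iff.rfl

theorem mem_cocycles {i n : ℤ} {c : ∀ S, Loc x M S} :
    c ∈ koszulCocycles 𝒜 ℳ x i n ↔ c ∈ koszulCochains 𝒜 ℳ x i n ∧ koszulD x M c = 0 :=
  Iff.rfl

theorem cochainMap_smulHom_mem_coboundaries {a : H} {δ : ℤ} (ha : a ∈ 𝒜 δ) {i n p : ℤ}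
    (hp : p = n + δ) {c : ∀ S, Loc x M S} (hc : c ∈ koszulCoboundaries 𝒜 ℳ x i n) :
    cochainMap x (smulHom M a) c ∈ koszulCoboundaries 𝒜 ℳ x i p := by
  obtain ⟨b, hb, rfl⟩ := mem_coboundaries.1 hc
  exact mem_coboundaries.2 ⟨_, cochainMap_smulHom_mem ha hp hb, (cochainMap_koszulD _ b).symm⟩

theorem cochainMap_smulHom_mem_cocycles {a : H} {δ : ℤ} (ha : a ∈ 𝒜 δ) {i n p : ℤ}
    (hp : p = n + δ) {c : ∀ S, Loc x M S} (hc : c ∈ koszulCocycles 𝒜 ℳ x i n) :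
    cochainMap x (smulHom M a) c ∈ koszulCocycles 𝒜 ℳ x i p := by
  obtain ⟨hc, hD⟩ := mem_cocycles.1 hc
  exact mem_cocycles.2 ⟨cochainMap_smulHom_mem ha hp hc,
    by rw [← cochainMap_koszulD, hD, map_zero]⟩

theorem exists_degree_of_mem_locSubmonoid {e : Fin s → ℤ}
    (he : ∀ l, x l ∈ 𝒜 (e l)) {S : Finset (Fin s)}
    {u : Subring.center H} (hu : u ∈ locSubmonoid x S) : ∃ d : ℤ, (u : H) ∈ 𝒜 d := by
  induction hu using Submonoid.closure_induction with
  | mem z hz =>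
    obtain ⟨l, _, hl⟩ := hz
    exact ⟨_, hl ▸ SetLike.pow_mem_graded 2 (he l)⟩
  | one => exact ⟨0, SetLike.GradedOne.one_mem⟩
  | mul a b _ _ ha hb =>
    obtain ⟨d, hd⟩ := ha
    obtain ⟨d', hd'⟩ := hb
    exact ⟨d + d', SetLike.GradedMul.mul_mem hd hd'⟩

/-- The square of a homogeneous generator, as an element of the center. -/
def centralSq (hH : IsConnectedGradedCommutative 𝒜) {e : Fin s → ℤ} (he : ∀ l, x l ∈ 𝒜 (e l))
    (l : Fin s) : Subring.center H :=
  ⟨x l ^ 2, sq_mem_center hH (he l)⟩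

variable (hH : IsConnectedGradedCommutative 𝒜) {e : Fin s → ℤ} (he : ∀ l, x l ∈ 𝒜 (e l))

theorem centralSq_pow_mem_degree (l : Fin s) (N : ℕ) :
    ((centralSq hH he l ^ N : Subring.center H) : H) ∈ 𝒜 (N * (2 * e l)) := by
  have := SetLike.pow_mem_graded N (SetLike.pow_mem_graded 2 (he l))
  simpa [centralSq] using this

theorem centralSq_mem_locSubmonoid {l : Fin s} {S : Finset (Fin s)} (hl : l ∈ S) :
    centralSq hH he l ∈ locSubmonoid x S :=
  Submonoid.subset_closure ⟨l, hl, rfl⟩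

/-- Localizing at `S ∪ {l}` amounts to localizing at `S` and inverting powers of `x l ^ 2`. -/
theorem exists_eq_mul_centralSq_pow {l : Fin s} {S : Finset (Fin s)}
    {u : Subring.center H} (hu : u ∈ locSubmonoid x (insert l S)) :
    ∃ (v : Subring.center H) (a : ℕ), v ∈ locSubmonoid x S ∧ u = centralSq hH he l ^ a * v := by
  induction hu using Submonoid.closure_induction with
  | mem z hz =>
    obtain ⟨j, hj, hz⟩ := hz
    rcases Finset.mem_insert.1 hj with rfl | hj
    · exact ⟨1, 1, one_mem _, Subtype.ext (by simpa [centralSq] using hz)⟩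
    · exact ⟨z, 0, Submonoid.subset_closure ⟨j, hj, hz⟩, by simp⟩
  | one => exact ⟨1, 0, one_mem _, by simp⟩
  | mul a b _ _ ha hb =>
    obtain ⟨v, p, hv, rfl⟩ := ha
    obtain ⟨v', p', hv', rfl⟩ := hb
    exact ⟨v * v', p + p', mul_mem hv hv', by ring⟩

theorem eq_one_of_mem_locSubmonoid_empty {u : Subring.center H} (hu : u ∈ locSubmonoid x ∅) :
    u = 1 := by
  have h : {z : Subring.center H | ∃ i ∈ (∅ : Finset (Fin s)), (z : H) = x i ^ 2} = ∅ := by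
    ext z
    simp
  rw [locSubmonoid, h, Submonoid.closure_empty] at hu
  exact hu

end Cochains

/-! ### Local cohomology is torsion -/

section Torsion

open DirectSum Filter

variable {k : Type u} [Field k] {H : Type v} [Ring H] [Algebra k H]
variable {𝒜 : ℤ → Submodule k H} [GradedAlgebra 𝒜]
variable {M : Type w} [AddCommGroup M] [Module H M] {ℳ : ℤ → AddSubgroup M}
  [SetLike.GradedSMul 𝒜 ℳ]
variable {s : ℕ} {x : Fin s → H}
variable (hH : IsConnectedGradedCommutative 𝒜) {e : Fin s → ℤ} (he : ∀ l, x l ∈ 𝒜 (e l))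

theorem centralSq_pow_smul_mem {l : Fin s} {N : ℕ} {i n p : ℤ} (hp : p = n + N * (2 * e l))
    {c : ∀ S, Loc x M S} (hc : c ∈ koszulCochains 𝒜 ℳ x i n) :
    centralSq hH he l ^ N • c ∈ koszulCochains 𝒜 ℳ x i p := by
  rw [← cochainMap_smulHom_center]
  exact cochainMap_smulHom_mem (centralSq_pow_mem_degree hH he l N) hp hc

theorem centralSq_pow_smul_mk {l : Fin s} {S : Finset (Fin s)} (N a : ℕ) (h : a ≤ N)
    (m : M) (u : locSubmonoid x (insert l S)) {v : Subring.center H} (hv : v ∈ locSubmonoid x S)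
    (hu : (u : Subring.center H) = centralSq hH he l ^ a * v) (h' : S ⊆ insert l S) :
    centralSq hH he l ^ N • (LocalizedModule.mk m u : Loc x M (insert l S)) =
      locMap x M h' (LocalizedModule.mk (centralSq hH he l ^ (N - a) • m) ⟨v, hv⟩) := by
  obtain ⟨u, hu'⟩ := u
  subst hu
  rw [locMap_mk, LocalizedModule.smul'_mk, LocalizedModule.mk_eq]
  refine ⟨1, ?_⟩
  simp only [Submonoid.smul_def, smul_smul, Submonoid.coe_one, one_mul]
  congr 1
  obtain ⟨b, rfl⟩ := Nat.exists_eq_add_of_le h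
  rw [Nat.add_sub_cancel_left]
  ring

/-- Every homogeneous element of the localization at `S ∪ {l}` comes, after multiplication by a
power of `x l ^ 2`, from a homogeneous element of the localization at `S`. -/
theorem eventually_exists_locMap_eq {l : Fin s} {S : Finset (Fin s)} {n : ℤ}
    {z : Loc x M (insert l S)} (hz : z ∈ locDegree 𝒜 ℳ x (insert l S) n) :
    ∀ᶠ N : ℕ in atTop, ∃ w ∈ locDegree 𝒜 ℳ x S (n + N * (2 * e l)),
      locMap x M (Finset.subset_insert l S) w = centralSq hH he l ^ N • z := by
  obtain ⟨d, m, u, hu, hm, rfl⟩ := hz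
  obtain ⟨v, a, hv, huv⟩ := exists_eq_mul_centralSq_pow hH he u.2
  filter_upwards [eventually_ge_atTop a] with N hN
  -- The degree of the denominator `u` is determined only if `u ≠ 0`.
  by_cases hu0 : ((u : Subring.center H) : H) = 0
  · refine ⟨0, zero_mem _, ?_⟩
    have : (LocalizedModule.mk m u : Loc x M (insert l S)) = 0 :=
      (mk_eq_zero_iff m u).2 ⟨u, u.2, by rw [hu0, zero_smul]⟩
    rw [this, map_zero, smul_zero]
  · refine ⟨_, ?_, (centralSq_pow_smul_mk hH he N a hN m u hv huv _).symm⟩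
    obtain ⟨d', hd'⟩ := exists_degree_of_mem_locSubmonoid he hv
    have hu' : ((u : Subring.center H) : H) ∈ 𝒜 (a * (2 * e l) + d') := by
      rw [huv]
      exact SetLike.GradedMul.mul_mem (centralSq_pow_mem_degree hH he l a) hd'
    have hdeg : d = a * (2 * e l) + d' :=
      DirectSum.degree_eq_of_mem_mem 𝒜 hu hu' hu0
    refine ⟨d', _, ⟨v, hv⟩, hd', ?_, rfl⟩
    refine smul_mem_degree (𝒜 := 𝒜) (centralSq_pow_mem_degree hH he l (N - a)) hm ?_
    rw [hdeg, Nat.cast_sub hN]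
    ring

/-- An element which vanishes after inverting `x l` is torsion with respect to `x l ^ 2`. -/
theorem eventually_smul_eq_zero {l : Fin s} {S : Finset (Fin s)} {z : Loc x M S}
    (hz : locMap x M (Finset.subset_insert l S) z = 0) :
    ∀ᶠ N : ℕ in atTop, centralSq hH he l ^ N • z = 0 := by
  induction z using LocalizedModule.induction_on with
  | h m u =>
    rw [locMap_mk, mk_eq_zero_iff] at hz
    obtain ⟨v, hv, hvm⟩ := hz
    obtain ⟨v', a, hv', rfl⟩ := exists_eq_mul_centralSq_pow hH he hv
    filter_upwards [eventually_ge_atTop a] with N hN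
    rw [LocalizedModule.smul'_mk, mk_eq_zero_iff]
    refine ⟨v', hv', ?_⟩
    change v' • centralSq hH he l ^ N • m = 0
    have h1 : (centralSq hH he l ^ a * v') • m = 0 := hvm
    rw [smul_smul, ← Nat.sub_add_cancel hN, pow_add, mul_comm v', mul_assoc, mul_smul, h1,
      smul_zero]

theorem locMap_component_congr (c : ∀ S, Loc x M S) {A B T : Finset (Fin s)} (hA : A ⊆ T)
    (hB : B ⊆ T) (h : A = B) : locMap x M hA (c A) = locMap x M hB (c B) := by
  subst h
  rfl

/-- The stable Koszul complex becomes contractible when a generator is inverted, so its cohomology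
is torsion with respect to each generator. -/
theorem eventually_smul_mem_coboundaries (l : Fin s) {i n : ℤ} {c : ∀ S, Loc x M S}
    (hc : c ∈ koszulCocycles 𝒜 ℳ x i n) :
    ∀ᶠ N : ℕ in atTop, centralSq hH he l ^ N • c ∈
      koszulCoboundaries 𝒜 ℳ x i (n + N * (2 * e l)) := by
  obtain ⟨hc, hDc⟩ := mem_cocycles.1 hc
  set y := centralSq hH he l with hy
  -- A contracting homotopy, after multiplication by a power of `y`.
  have h1 : ∀ S : Finset (Fin s), ∀ᶠ N : ℕ in atTop, ∃ w ∈ locDegree 𝒜 ℳ x S (n + N * (2 * e l)),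
      ((S.card : ℤ) ≠ i - 1 → w = 0) ∧ (l ∈ S → w = 0) ∧
      (l ∉ S → locMap x M (Finset.subset_insert l S) w = y ^ N • c (insert l S)) := by
    intro S
    by_cases hl : l ∈ S
    · exact .of_forall fun N => ⟨0, zero_mem _, fun _ => rfl, fun _ => rfl, fun h => (h hl).elim⟩
    by_cases hS : (S.card : ℤ) = i - 1
    · filter_upwards [eventually_exists_locMap_eq hH he (hc (insert l S)).1] with N ⟨w, hw, hw'⟩
      exact ⟨w, hw, fun h => (h hS).elim, fun h => (hl h).elim, fun _ => hw'⟩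
    · refine .of_forall fun N => ⟨0, zero_mem _, fun _ => rfl, fun _ => rfl, fun _ => ?_⟩
      rw [(hc (insert l S)).2, map_zero, smul_zero]
      rw [Finset.card_insert_of_notMem hl]
      push_cast
      omega
  obtain ⟨N₁, hN₁⟩ := (eventually_all.2 h1).exists
  choose w hw hwi hwl hw' using hN₁
  let b : ∀ S, Loc x M S := fun S => (-1 : Subring.center H) ^ (S.filter (· < l)).card • w S
  have hb : b ∈ koszulCochains 𝒜 ℳ x (i - 1) (n + N₁ * (2 * e l)) := by
    intro S
    constructor
    · rcases neg_one_pow_eq_or (Subring.center H) (S.filter (· < l)).card with h | h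
      · simpa [b, h] using hw S
      · simpa [b, h] using hw S
    · intro hS
      simp [b, hwi S hS]
  -- The cocycle `f` vanishes at the sets containing `l`, so `D f = 0` at `S ∪ {l}` says that `f S`
  -- vanishes after inverting `x l`.
  let f : ∀ S, Loc x M S := y ^ N₁ • c - koszulD x M b
  have hDf : koszulD x M f = 0 := by
    simp only [f]
    rw [map_sub, koszulD_smul, hDc, smul_zero, koszulD_koszulD, sub_zero]
  have hfl : ∀ T, l ∈ T → f T = 0 := by
    intro T hl
    have h2 : koszulD x M b T = y ^ N₁ • c T := by
      rw [koszulD_apply, Finset.sum_eq_single l]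
      · have h3 : (T.erase l).filter (· < l) = T.filter (· < l) := by
          rw [Finset.filter_erase, Finset.erase_eq_of_notMem (by simp)]
        simp only [b, h3, map_smul, smul_smul, ← pow_add]
        rw [(Even.add_self _).neg_one_pow, one_smul]
        have h4 := hw' (T.erase l) (Finset.notMem_erase l T)
        have h5 : ∀ (T' : Finset (Fin s)) (h : insert l (T.erase l) = T') (h' : T.erase l ⊆ T'),
            locMap x M h' (w (T.erase l)) = y ^ N₁ • c T' := by
          rintro _ rfl _
          exact h4
        exact h5 T (Finset.insert_erase hl) _
      · intro j hj hjl
        have : w (T.erase j) = 0 := hwl _ (Finset.mem_erase.2 ⟨hjl.symm, hl⟩)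
        simp [b, this]
      · exact fun h => (h hl).elim
    simp [f, h2]
  have h6 : ∀ S : Finset (Fin s), ∀ᶠ N : ℕ in atTop, y ^ N • f S = 0 := by
    intro S
    by_cases hl : l ∈ S
    · exact .of_forall fun N => by rw [hfl S hl, smul_zero]
    refine eventually_smul_eq_zero hH he ?_
    have h7 := congrFun hDf (insert l S)
    rw [koszulD_apply, Finset.sum_eq_single l] at h7
    · have h8 : locMap x M ((insert l S).erase_subset l) (f ((insert l S).erase l)) = 0 := by
        rcases neg_one_pow_eq_or (Subring.center H) ((insert l S).filter (· < l)).card with h | h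
        · simpa [h] using h7
        · simpa [h] using h7
      rwa [locMap_component_congr f _ (Finset.subset_insert l S) (Finset.erase_insert hl)] at h8
    · intro j _ hj
      rw [hfl _ (Finset.mem_erase.2 ⟨hj.symm, Finset.mem_insert_self l S⟩), map_zero, smul_zero]
    · exact fun h => (h (Finset.mem_insert_self l S)).elim
  obtain ⟨N₂, hN₂⟩ := eventually_atTop.1 (eventually_all.2 h6)
  filter_upwards [eventually_ge_atTop (N₁ + N₂)] with N hN
  refine mem_coboundaries.2 ⟨y ^ (N - N₁) • b, centralSq_pow_smul_mem hH he ?_ hb, ?_⟩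
  · rw [Nat.cast_sub (by omega)]
    ring
  · have h9 : y ^ (N - N₁) • f = 0 := funext fun S => hN₂ (N - N₁) (by omega) S
    simp only [f] at h9
    rw [smul_sub, smul_smul, ← pow_add, Nat.sub_add_cancel (by omega), sub_eq_zero] at h9
    rw [koszulD_smul, h9]

/-- Every class in local cohomology is annihilated by all homogeneous elements of large degree,
since these lie in the ideal generated by powers of the squares of the generators. -/
theorem exists_smulHom_mem_coboundaries (hH : IsConnectedGradedCommutative 𝒜)
    {e : Fin s → ℤ} (he : ∀ l, x l ∈ 𝒜 (e l)) (hx : Algebra.adjoin k (Set.range x) = ⊤)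
    {i n : ℤ} {c : ∀ S, Loc x M S} (hc : c ∈ koszulCocycles 𝒜 ℳ x i n) :
    ∃ D₀ : ℤ, ∀ D, D₀ ≤ D → ∀ a ∈ 𝒜 D,
      cochainMap x (smulHom M a) c ∈ koszulCoboundaries 𝒜 ℳ x i (n + D) := by
  obtain ⟨N, hN⟩ :=
    (eventually_all.2 fun l => eventually_smul_mem_coboundaries hH he l hc).exists
  obtain ⟨D₀, hD₀⟩ := exists_eq_sum_mul_sq_pow hH hx he N
  refine ⟨D₀, fun D hD a ha => ?_⟩
  obtain ⟨h, hh, rfl⟩ := hD₀ D hD a ha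
  have h1 : smulHom M (∑ l, h l * (x l ^ 2) ^ N) =
      ∑ l, (smulHom M (h l)).comp (smulHom M ((centralSq hH he l ^ N : Subring.center H) : H)) := by
    ext m
    simp [Finset.sum_smul, mul_smul, centralSq, LinearMap.sum_apply]
  rw [h1, cochainMap_sum]
  refine sum_mem fun l _ => ?_
  rw [← cochainMap_comp, cochainMap_smulHom_center]
  exact cochainMap_smulHom_mem_coboundaries (hh l) (by ring) (hN l)

end Torsion

/-! ### Multiplication by a filter-regular element on local cohomology -/

section Chase

open DirectSum Filter

variable {k : Type u} [Field k] {H : Type v} [Ring H] [Algebra k H]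
variable {𝒜 : ℤ → Submodule k H} [GradedAlgebra 𝒜]
variable {M : Type w} [AddCommGroup M] [Module H M] {ℳ : ℤ → AddSubgroup M}
  [SetLike.GradedSMul 𝒜 ℳ]
variable {s : ℕ} {x : Fin s → H}

/-- The degree `n` part of the `i`-th local cohomology vanishes. -/
def Vanishes (𝒜 : ℤ → Submodule k H) [GradedAlgebra 𝒜] (ℳ : ℤ → AddSubgroup M)
    [SetLike.GradedSMul 𝒜 ℳ] (x : Fin s → H) (i n : ℤ) : Prop :=
  koszulCocycles 𝒜 ℳ x i n ≤ koszulCoboundaries 𝒜 ℳ x i n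

/-- The kernel of multiplication by `a` on `M` vanishes in large degrees. -/
def HasBoundedKernel (ℳ : ℤ → AddSubgroup M) (a : H) : Prop :=
  ∃ B : ℤ, ∀ j, B < j → ∀ m ∈ ℳ j, a • m = 0 → m = 0

/-- Cochains lift along quotient maps, preserving both degrees. -/
theorem exists_lift_cochain (N : Submodule H M) {i n : ℤ} {c : ∀ S, Loc x (M ⧸ N) S}
    (hc : c ∈ koszulCochains 𝒜 (quotientGrading ℳ N) x i n) :
    ∃ b ∈ koszulCochains 𝒜 ℳ x i n, cochainMap x (centerMkQ N) b = c := by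
  have h : ∀ S, ∃ z ∈ locDegree 𝒜 ℳ x S n, ((S.card : ℤ) ≠ i → z = 0) ∧
      locFunctor x (centerMkQ N) S z = c S := by
    intro S
    by_cases hS : (S.card : ℤ) = i
    · obtain ⟨d, _, u, hu, ⟨m, hm, rfl⟩, h⟩ := (hc S).1
      exact ⟨LocalizedModule.mk m u, ⟨d, m, u, hu, hm, rfl⟩, fun h => (h hS).elim,
        by rw [h, locFunctor_mk]; rfl⟩
    · exact ⟨0, zero_mem _, fun _ => rfl, by rw [(hc S).2 hS, map_zero]⟩
  choose b hb hb' hb'' using h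
  exact ⟨b, fun S => ⟨hb S, hb' S⟩, funext hb''⟩

/-- A cochain of `M` which vanishes in `M / aM` is divisible by `a`. -/
theorem exists_smulHom_eq_of_map_eq_zero [DirectSum.Decomposition ℳ]
    (hH : IsConnectedGradedCommutative 𝒜)
    {e : Fin s → ℤ} (he : ∀ l, x l ∈ 𝒜 (e l)) {δ : ℤ} {a : H} (ha : a ∈ 𝒜 δ) {i n : ℤ}
    {c : ∀ S, Loc x M S} (hc : c ∈ koszulCochains 𝒜 ℳ x i (n + δ))
    (h : cochainMap x (centerMkQ (mulSubmodule M a)) c = 0) :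
    ∃ b ∈ koszulCochains 𝒜 ℳ x i n, cochainMap x (smulHom M a) b = c := by
  have h : ∀ S, ∃ z ∈ locDegree 𝒜 ℳ x S n, ((S.card : ℤ) ≠ i → z = 0) ∧
      locFunctor x (smulHom M a) S z = c S := by
    intro S
    by_cases hS : (S.card : ℤ) = i
    · obtain ⟨d, m, u, hu, hm, h'⟩ := (hc S).1
      have h1 : locFunctor x (centerMkQ (mulSubmodule M a)) S (c S) = 0 := congrFun h S
      rw [h', locFunctor_mk, mk_eq_zero_iff] at h1
      obtain ⟨v, hv, h1⟩ := h1
      obtain ⟨d', hd'⟩ := exists_degree_of_mem_locSubmonoid he hv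
      have h2 : (v : H) • m ∈ mulSubmodule M a :=
        (Submodule.Quotient.mk_eq_zero _).1 h1
      obtain ⟨m', hm', hm''⟩ := exists_homogeneous_of_mem_mulSubmodule (𝒜 := 𝒜) (ℳ := ℳ) hH
        (j := n + (d' + d)) ha h2 (smul_mem_degree hd' hm (by ring))
      refine ⟨LocalizedModule.mk m' (⟨v, hv⟩ * u), ⟨d' + d, m', _,
        SetLike.GradedMul.mul_mem hd' hu, hm', rfl⟩, fun h => (h hS).elim, ?_⟩
      rw [locFunctor_mk, smulHom_apply, ← hm'', h']
      exact LocalizedModule.mk_cancel_common_left (⟨v, hv⟩ : locSubmonoid x S) u m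
    · exact ⟨0, zero_mem _, fun _ => rfl, by rw [(hc S).2 hS, map_zero]⟩
  choose b hb hb' hb'' using h
  exact ⟨b, fun S => ⟨hb S, hb' S⟩, funext hb''⟩

theorem eventually_centralSq_smul_eq_zero (hH : IsConnectedGradedCommutative 𝒜)
    {e : Fin s → ℤ} (he : ∀ l, x l ∈ 𝒜 (e l)) (hpos : ∀ l, 0 < e l) {a : H}
    (hK : HasBoundedKernel ℳ a) (l : Fin s) {j : ℤ} {m : M} (hm : m ∈ ℳ j) (ham : a • m = 0) :
    ∀ᶠ N : ℕ in atTop, centralSq hH he l ^ N • m = 0 := by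
  obtain ⟨B, hB⟩ := hK
  filter_upwards [eventually_ge_atTop (B - j + 1).toNat] with N hN
  refine hB (N * (2 * e l) + j) ?_ _
    (smul_mem_degree (𝒜 := 𝒜) (a := ((centralSq hH he l ^ N : Subring.center H) : H))
      (centralSq_pow_mem_degree hH he l N) hm rfl) ?_
  · have h1 : B - j + 1 ≤ N := by omega
    have h2 : (N : ℤ) ≤ N * (2 * e l) := le_mul_of_one_le_right (by omega) (by linarith [hpos l])
    omega
  · have := (smulHom M a).map_smul (centralSq hH he l ^ N) m
    rw [smulHom_apply, smulHom_apply, ham, smul_zero] at this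
    exact this

/-- If the kernel of `a` is bounded above, it vanishes in every localization at a nonempty set of
generators; so `a` acts injectively on cochains of nonzero cohomological degree. -/
theorem eq_zero_of_smulHom_eq_zero (hH : IsConnectedGradedCommutative 𝒜)
    {e : Fin s → ℤ} (he : ∀ l, x l ∈ 𝒜 (e l)) (hpos : ∀ l, 0 < e l) {a : H}
    (hK : HasBoundedKernel ℳ a) {i n : ℤ} (hi : i ≠ 0) {c : ∀ S, Loc x M S}
    (hc : c ∈ koszulCochains 𝒜 ℳ x i n) (h : cochainMap x (smulHom M a) c = 0) : c = 0 := by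
  funext S
  by_cases hS : (S.card : ℤ) = i
  · obtain ⟨l, hl⟩ : S.Nonempty := by
      rw [← Finset.card_pos]
      omega
    obtain ⟨d, m, u, hu, hm, h'⟩ := (hc S).1
    have h1 : locFunctor x (smulHom M a) S (c S) = 0 := congrFun h S
    rw [h', locFunctor_mk, mk_eq_zero_iff] at h1
    obtain ⟨v, hv, h1⟩ := h1
    obtain ⟨d', hd'⟩ := exists_degree_of_mem_locSubmonoid he hv
    have h2 : a • v • m = 0 := ((smulHom M a).map_smul v m).trans h1
    obtain ⟨N, hN⟩ := (eventually_centralSq_smul_eq_zero hH he hpos hK l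
      (smul_mem_degree hd' hm rfl : (v : H) • m ∈ ℳ _) h2).exists
    rw [h', Pi.zero_apply, mk_eq_zero_iff]
    refine ⟨centralSq hH he l ^ N * v,
      mul_mem (pow_mem (centralSq_mem_locSubmonoid hH he hl) N) hv, ?_⟩
    rw [Subring.coe_mul, mul_smul]
    exact hN
  · exact (hc S).2 hS

theorem centerMkQ_smulHom (a : H) (c : ∀ S, Loc x M S) :
    cochainMap x (centerMkQ (mulSubmodule M a)) (cochainMap x (smulHom M a) c) = 0 := by
  have : (centerMkQ (mulSubmodule M a)).comp (smulHom M a) = 0 := by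
    ext m
    exact (Submodule.Quotient.mk_eq_zero _).2 (Submodule.subset_span ⟨m, rfl⟩)
  rw [cochainMap_comp, this, cochainMap_zero]

theorem centerMkQ_mem (N : Submodule H M) {i n : ℤ} {c : ∀ S, Loc x M S}
    (hc : c ∈ koszulCochains 𝒜 ℳ x i n) :
    cochainMap x (centerMkQ N) c ∈ koszulCochains 𝒜 (quotientGrading ℳ N) x i n :=
  cochainMap_mem (ℳ := ℳ) (ℳ' := quotientGrading ℳ N) (δ := 0)
    (fun j m hm => ⟨m, by simpa using hm, rfl⟩) (by ring) hc

/-- The part `Hⁱ⁻¹(M/aM) → Hⁱ(M) → Hⁱ(M)` of the long exact sequence, where `i ≠ 0`: if the first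
term vanishes, then `a` acts injectively on `Hⁱ(M)`. -/
theorem mem_coboundaries_of_smulHom_mem [DirectSum.Decomposition ℳ]
    (hH : IsConnectedGradedCommutative 𝒜)
    {e : Fin s → ℤ} (he : ∀ l, x l ∈ 𝒜 (e l)) (hpos : ∀ l, 0 < e l) {δ : ℤ} {a : H}
    (ha : a ∈ 𝒜 δ) (hK : HasBoundedKernel ℳ a) {i n : ℤ} (hi : i ≠ 0)
    (hV : Vanishes 𝒜 (quotientGrading ℳ (mulSubmodule M a)) x (i - 1) (n + δ))
    {c : ∀ S, Loc x M S} (hc : c ∈ koszulCocycles 𝒜 ℳ x i n)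
    (h : cochainMap x (smulHom M a) c ∈ koszulCoboundaries 𝒜 ℳ x i (n + δ)) :
    c ∈ koszulCoboundaries 𝒜 ℳ x i n := by
  obtain ⟨hc, hDc⟩ := mem_cocycles.1 hc
  obtain ⟨b, hb, hbc⟩ := mem_coboundaries.1 h
  have h1 : cochainMap x (centerMkQ (mulSubmodule M a)) b ∈
      koszulCocycles 𝒜 (quotientGrading ℳ (mulSubmodule M a)) x (i - 1) (n + δ) :=
    mem_cocycles.2 ⟨centerMkQ_mem _ hb, by rw [← cochainMap_koszulD, hbc, centerMkQ_smulHom]⟩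
  obtain ⟨f', hf', hfb⟩ := mem_coboundaries.1 (hV h1)
  obtain ⟨f, hf, rfl⟩ := exists_lift_cochain _ hf'
  have h2 : b - koszulD x M f ∈ koszulCochains 𝒜 ℳ x (i - 1) (n + δ) := by
    refine sub_mem hb ?_
    have := koszulD_mem 𝒜 ℳ x _ _ hf
    rwa [sub_add_cancel] at this
  obtain ⟨g, hg, hgb⟩ := exists_smulHom_eq_of_map_eq_zero hH he ha h2
    (by rw [map_sub, cochainMap_koszulD, hfb, sub_self])
  refine mem_coboundaries.2 ⟨g, hg, ?_⟩
  have h3 : koszulD x M g ∈ koszulCochains 𝒜 ℳ x i n := by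
    have := koszulD_mem 𝒜 ℳ x _ _ hg
    rwa [sub_add_cancel] at this
  refine sub_eq_zero.1 (eq_zero_of_smulHom_eq_zero hH he hpos hK hi (sub_mem h3 hc) ?_)
  rw [map_sub, cochainMap_koszulD, hgb, map_sub, koszulD_koszulD, sub_zero, hbc, sub_self]

/-- The part `Hⁱ(M) → Hⁱ(M/aM) → Hⁱ⁺¹(M)` of the long exact sequence: if the outer terms vanish, so
does the middle one. -/
theorem vanishes_quotient [DirectSum.Decomposition ℳ]
    (hH : IsConnectedGradedCommutative 𝒜)
    {e : Fin s → ℤ} (he : ∀ l, x l ∈ 𝒜 (e l)) (hpos : ∀ l, 0 < e l) {δ : ℤ} {a : H}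
    (ha : a ∈ 𝒜 δ) (hK : HasBoundedKernel ℳ a) {i n : ℤ} (hi : 0 ≤ i)
    (hV : Vanishes 𝒜 ℳ x i (n + δ)) (hV' : Vanishes 𝒜 ℳ x (i + 1) n) :
    Vanishes 𝒜 (quotientGrading ℳ (mulSubmodule M a)) x i (n + δ) := by
  intro c' hc'
  obtain ⟨hc', hDc'⟩ := mem_cocycles.1 hc'
  obtain ⟨c, hc, rfl⟩ := exists_lift_cochain _ hc'
  obtain ⟨b, hb, hbc⟩ := exists_smulHom_eq_of_map_eq_zero hH he ha (koszulD_mem 𝒜 ℳ x _ _ hc)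
    (by rw [cochainMap_koszulD, hDc'])
  have h1 : b ∈ koszulCocycles 𝒜 ℳ x (i + 1) n := by
    refine mem_cocycles.2 ⟨hb, ?_⟩
    refine eq_zero_of_smulHom_eq_zero hH he hpos hK (by omega) (koszulD_mem 𝒜 ℳ x _ _ hb) ?_
    rw [cochainMap_koszulD, hbc, koszulD_koszulD]
  obtain ⟨f, hf, rfl⟩ := mem_coboundaries.1 (hV' h1)
  rw [add_sub_cancel_right] at hf
  have h2 : c - cochainMap x (smulHom M a) f ∈ koszulCocycles 𝒜 ℳ x i (n + δ) := by
    refine mem_cocycles.2 ⟨sub_mem hc (cochainMap_smulHom_mem ha rfl hf), ?_⟩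
    rw [map_sub, ← cochainMap_koszulD, hbc, sub_self]
  obtain ⟨g, hg, hgc⟩ := mem_coboundaries.1 (hV h2)
  refine mem_coboundaries.2 ⟨_, centerMkQ_mem _ hg, ?_⟩
  rw [← cochainMap_koszulD, hgc, map_sub, centerMkQ_smulHom, sub_zero]

/-- If `a` acts injectively on `Hⁱ(M)` in all degrees `> D`, then `Hⁱ(M)` vanishes in these degrees,
since every class is killed by a power of `a`. -/
theorem vanishes_of_smulHom_injective (hH : IsConnectedGradedCommutative 𝒜)
    {e : Fin s → ℤ} (he : ∀ l, x l ∈ 𝒜 (e l)) (hx : Algebra.adjoin k (Set.range x) = ⊤)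
    {δ : ℤ} (hδ : 0 < δ) {a : H} (ha : a ∈ 𝒜 δ) {i D : ℤ}
    (hinj : ∀ n, D < n → ∀ c ∈ koszulCocycles 𝒜 ℳ x i n,
      cochainMap x (smulHom M a) c ∈ koszulCoboundaries 𝒜 ℳ x i (n + δ) →
      c ∈ koszulCoboundaries 𝒜 ℳ x i n) {n : ℤ} (hn : D < n) : Vanishes 𝒜 ℳ x i n := by
  have key : ∀ (N : ℕ) (n : ℤ), D < n → ∀ c ∈ koszulCocycles 𝒜 ℳ x i n,
      cochainMap x (smulHom M (a ^ N)) c ∈ koszulCoboundaries 𝒜 ℳ x i (n + N * δ) →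
      c ∈ koszulCoboundaries 𝒜 ℳ x i n := by
    intro N
    induction N with
    | zero =>
      intro n _ c _ h
      have h1 := cochainMap_smulHom_center (M := M) (x := x) 1 c
      simp only [Subring.coe_one, one_smul] at h1
      simpa [h1] using h
    | succ N ih =>
      intro n hn c hc h
      refine hinj n hn c hc (ih _ (by omega) _ (cochainMap_smulHom_mem_cocycles ha rfl hc) ?_)
      have h1 : (smulHom M (a ^ N)).comp (smulHom M a) = smulHom M (a ^ (N + 1)) := by
        ext m
        simp [pow_succ, mul_smul]
      rw [cochainMap_comp, h1]
      convert h using 2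
      push_cast
      ring
  intro c hc
  obtain ⟨D₀, hD₀⟩ := exists_smulHom_mem_coboundaries hH he hx hc
  refine key D₀.toNat n hn c hc (hD₀ _ ?_ _ ?_)
  · have : (D₀.toNat : ℤ) ≤ D₀.toNat * δ := le_mul_of_one_le_right (by omega) (by omega)
    omega
  · simpa using SetLike.pow_mem_graded D₀.toNat ha

end Chase

/-! ### Local cohomology in degree zero and of bounded modules -/

section DegreeZero

open DirectSum Filter

variable {k : Type u} [Field k] {H : Type v} [Ring H] [Algebra k H]
variable {𝒜 : ℤ → Submodule k H} [GradedAlgebra 𝒜]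
variable {M : Type w} [AddCommGroup M] [Module H M] {ℳ : ℤ → AddSubgroup M}
  [SetLike.GradedSMul 𝒜 ℳ]
variable {s : ℕ} {x : Fin s → H}

theorem eq_zero_of_mem_coboundaries_zero {n : ℤ} {c : ∀ S, Loc x M S}
    (hc : c ∈ koszulCoboundaries 𝒜 ℳ x 0 n) : c = 0 := by
  obtain ⟨b, hb, rfl⟩ := mem_coboundaries.1 hc
  have : b = 0 := funext fun S => (hb S).2 (by omega)
  rw [this, map_zero]

theorem exists_eq_mk_one (hH : IsConnectedGradedCommutative 𝒜) {n : ℤ} {z : Loc x M ∅}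
    (hz : z ∈ locDegree 𝒜 ℳ x ∅ n) : ∃ m ∈ ℳ n, z = LocalizedModule.mk m 1 := by
  have := hH.algebraMap_injective.nontrivial
  obtain ⟨d, m, ⟨u, hu'⟩, hu, hm, rfl⟩ := hz
  obtain rfl := eq_one_of_mem_locSubmonoid_empty hu'
  have : d = 0 := DirectSum.degree_eq_of_mem_mem 𝒜 (x := (1 : H)) hu SetLike.GradedOne.one_mem
    one_ne_zero
  subst this
  exact ⟨m, by simpa using hm, rfl⟩

theorem mk_empty_eq_zero_iff {m : M} :
    (LocalizedModule.mk m 1 : Loc x M ∅) = 0 ↔ m = 0 := by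
  rw [mk_eq_zero_iff]
  constructor
  · rintro ⟨v, hv, h⟩
    obtain rfl := eq_one_of_mem_locSubmonoid_empty hv
    simpa using h
  · rintro rfl
    exact ⟨1, one_mem _, by simp⟩

theorem exists_eq_mk_of_mem_cochains_zero (hH : IsConnectedGradedCommutative 𝒜) {n : ℤ}
    {c : ∀ S, Loc x M S} (hc : c ∈ koszulCochains 𝒜 ℳ x 0 n) :
    ∃ m ∈ ℳ n, c ∅ = LocalizedModule.mk m 1 ∧ (m = 0 → c = 0) := by
  obtain ⟨m, hm, h⟩ := exists_eq_mk_one hH (hc ∅).1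
  refine ⟨m, hm, h, ?_⟩
  rintro rfl
  funext S
  by_cases hS : S = ∅
  · subst hS
    rw [h, mk_empty_eq_zero_iff.2 rfl]
    rfl
  · exact (hc S).2 (by simpa using hS)

theorem vanishes_zero_of_eq_zero (hH : IsConnectedGradedCommutative 𝒜) {n : ℤ}
    (h : ∀ m ∈ ℳ n, m = 0) : Vanishes 𝒜 ℳ x 0 n := by
  intro c hc
  obtain ⟨m, hm, -, h'⟩ := exists_eq_mk_of_mem_cochains_zero hH (mem_cocycles.1 hc).1
  rw [h' (h m hm)]
  exact zero_mem _

theorem vanishes_zero_of_injective (hH : IsConnectedGradedCommutative 𝒜)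
    {e : Fin s → ℤ} (he : ∀ l, x l ∈ 𝒜 (e l)) (hx : Algebra.adjoin k (Set.range x) = ⊤)
    {δ : ℤ} (hδ : 0 < δ) {a : H} (ha : a ∈ 𝒜 δ) {D : ℤ}
    (hinj : ∀ n, D < n → ∀ m ∈ ℳ n, a • m = 0 → m = 0) {n : ℤ} (hn : D < n) :
    Vanishes 𝒜 ℳ x 0 n := by
  refine vanishes_of_smulHom_injective hH he hx hδ ha (fun n hn c hc h => ?_) hn
  obtain ⟨m, hm, h1, h2⟩ := exists_eq_mk_of_mem_cochains_zero hH (mem_cocycles.1 hc).1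
  have h3 : locFunctor x (smulHom M a) ∅ (c ∅) = 0 :=
    congrFun (eq_zero_of_mem_coboundaries_zero h) ∅
  rw [h1, locFunctor_mk, mk_empty_eq_zero_iff] at h3
  rw [h2 (hinj n hn m hm h3)]
  exact zero_mem _

/-- A torsion element of `M` defines a class in `H⁰(M)`, so it is zero if `H⁰(M)` vanishes in its
degree. -/
theorem eq_zero_of_vanishes_zero (hH : IsConnectedGradedCommutative 𝒜)
    {e : Fin s → ℤ} (he : ∀ l, x l ∈ 𝒜 (e l)) {n : ℤ}
    (hV : Vanishes 𝒜 ℳ x 0 n) {m : M} (hm : m ∈ ℳ n)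
    (htors : ∀ l, ∃ N : ℕ, centralSq hH he l ^ N • m = 0) : m = 0 := by
  classical
  let c : ∀ S, Loc x M S := fun S => if S = ∅ then LocalizedModule.mk m 1 else 0
  have hc : c ∈ koszulCocycles 𝒜 ℳ x 0 n := by
    refine mem_cocycles.2 ⟨fun S => ⟨?_, ?_⟩, ?_⟩
    · by_cases hS : S = ∅
      · simp only [c, hS, if_true]
        exact ⟨0, m, 1, SetLike.GradedOne.one_mem, by simpa using hm, rfl⟩
      · simp [c, hS]
    · intro hS
      simp [c, show S ≠ ∅ by simpa using hS]
    · funext T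
      rw [koszulD_apply, Pi.zero_apply]
      refine Finset.sum_eq_zero fun l hl => ?_
      by_cases hT : T.erase l = ∅
      · simp only [c, hT, if_true]
        rw [locMap_mk]
        convert smul_zero _
        rw [mk_eq_zero_iff]
        obtain ⟨N, hN⟩ := htors l
        exact ⟨_, pow_mem (centralSq_mem_locSubmonoid hH he hl) N, hN⟩
      · simp [c, hT]
  have h := congrFun (eq_zero_of_mem_coboundaries_zero (hV hc)) ∅
  simpa [c, mk_empty_eq_zero_iff] using h

/-- Local cohomology in positive cohomological degrees vanishes for a module which is bounded
above. -/
theorem vanishes_of_bounded (hH : IsConnectedGradedCommutative 𝒜)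
    {e : Fin s → ℤ} (he : ∀ l, x l ∈ 𝒜 (e l)) (hpos : ∀ l, 0 < e l) {B : ℤ}
    (hB : ∀ j, B < j → ∀ m ∈ ℳ j, m = 0) {i : ℤ} (hi : i ≠ 0) (n : ℤ) : Vanishes 𝒜 ℳ x i n := by
  intro c hc
  have hc := (mem_cocycles.1 hc).1
  -- Here the kernel of multiplication by `0`, which is `M`, is bounded above.
  have h0 : smulHom M (0 : H) = 0 := by
    ext m
    simp
  have : c = 0 := eq_zero_of_smulHom_eq_zero hH he hpos
    (a := 0) ⟨B, fun j hj m hm _ => hB j hj m hm⟩ hi hc (by rw [h0, cochainMap_zero])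
  rw [this]
  exact zero_mem _

end DegreeZero

/-! ### Filter-regular sequences and the vanishing of local cohomology -/

section RegularSequences

open DirectSum Filter

variable {k : Type u} [Field k] {H : Type v} [Ring H] [Algebra k H]
variable {M : Type w} [AddCommGroup M] [Module H M] {r : ℕ}

/-- The conditions for a filter-regular sequence of a given type, except that
`M/(ζ₁, …, ζᵣ)M` is of finite length. -/
structure IsRegularOfType (𝒜 : ℤ → Submodule k H) (ℳ : ℤ → AddSubgroup M)
    (ζ : Fin r → H) (n : Fin r → ℤ) (d : Fin (r + 1) → ℤ) : Prop where
  pos : ∀ i, 0 < n i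
  homogeneous : ∀ i, ζ i ∈ 𝒜 (n i)
  injective : ∀ (i : Fin r) (j : ℤ), prefixSum n i + d i.castSucc < j →
    ∀ m ∈ ℳ j, ζ i • m ∈ prefixSubmodule M ζ i → m ∈ prefixSubmodule M ζ i
  vanishing : ∀ j : ℤ, prefixSum n r + d (Fin.last r) < j →
    ∀ m ∈ ℳ j, m ∈ prefixSubmodule M ζ r

theorem IsFilterRegularOfType.isRegularOfType {𝒜 : ℤ → Submodule k H} {ℳ : ℤ → AddSubgroup M}
    {ζ : Fin r → H} {n : Fin r → ℤ} {d : Fin (r + 1) → ℤ}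
    (h : IsFilterRegularOfType 𝒜 ℳ ζ n d) : IsRegularOfType 𝒜 ℳ ζ n d :=
  ⟨h.hsop.pos, h.hsop.homogeneous, h.injective, h.vanishing⟩

theorem prefixSubmodule_zero (ζ : Fin r → H) : prefixSubmodule M ζ 0 = ⊥ := by
  rw [prefixSubmodule, Submodule.span_eq_bot]
  rintro y ⟨j, m, hj, -⟩
  omega

theorem prefixSum_zero (n : Fin r → ℤ) : prefixSum n 0 = 0 := by
  simp [prefixSum]

theorem prefixSum_succ (n : Fin (r + 1) → ℤ) (i : ℕ) :
    prefixSum n (i + 1) = n 0 + prefixSum (Fin.tail n) i := by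
  simp [prefixSum, Finset.sum_filter, Fin.sum_univ_succ, Fin.tail]

/-- The preimage in `M` of `(ζ₂, …, ζᵢ₊₁)(M/ζ₁M)` is `(ζ₁, …, ζᵢ₊₁)M`. -/
theorem mkQ_mem_prefixSubmodule_tail (ζ : Fin (r + 1) → H) (i : ℕ) (y : M) :
    (mulSubmodule M (ζ 0)).mkQ y ∈
        prefixSubmodule (M ⧸ mulSubmodule M (ζ 0)) (Fin.tail ζ) i ↔
      y ∈ prefixSubmodule M ζ (i + 1) := by
  have h0 : mulSubmodule M (ζ 0) ≤ prefixSubmodule M ζ (i + 1) := by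
    refine Submodule.span_le.2 ?_
    rintro _ ⟨m, rfl⟩
    exact Submodule.subset_span ⟨0, m, by simp, rfl⟩
  constructor
  · have h1 : prefixSubmodule (M ⧸ mulSubmodule M (ζ 0)) (Fin.tail ζ) i ≤
        (prefixSubmodule M ζ (i + 1)).map (mulSubmodule M (ζ 0)).mkQ := by
      refine Submodule.span_le.2 ?_
      rintro _ ⟨j, q, hj, rfl⟩
      obtain ⟨m, rfl⟩ := (mulSubmodule M (ζ 0)).mkQ_surjective q
      exact ⟨ζ j.succ • m, Submodule.subset_span ⟨j.succ, m, by simpa using hj, rfl⟩,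
        map_smul _ _ _⟩
    intro h
    obtain ⟨p, hp, hpy⟩ := h1 h
    have h2 : p - y ∈ mulSubmodule M (ζ 0) := by
      rw [← Submodule.Quotient.mk_eq_zero, Submodule.Quotient.mk_sub, sub_eq_zero]
      exact hpy
    simpa using sub_mem hp (h0 h2)
  · have h1 : prefixSubmodule M ζ (i + 1) ≤
        (prefixSubmodule (M ⧸ mulSubmodule M (ζ 0)) (Fin.tail ζ) i).comap
          (mulSubmodule M (ζ 0)).mkQ := by
      refine Submodule.span_le.2 ?_
      rintro _ ⟨j, m, hj, rfl⟩
      simp only [Submodule.comap_coe, Set.mem_preimage, SetLike.mem_coe]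
      refine Fin.cases (fun _ => ?_) (fun j hj => ?_) j hj
      · have h2 : (mulSubmodule M (ζ 0)).mkQ (ζ 0 • m) = 0 :=
          (Submodule.Quotient.mk_eq_zero _).2 (Submodule.subset_span ⟨m, rfl⟩)
        rw [h2]
        exact zero_mem _
      · exact Submodule.subset_span ⟨j, (mulSubmodule M (ζ 0)).mkQ m, by simpa using hj,
          map_smul _ _ _⟩
    exact fun h => h1 h

theorem isRegularOfType_zero_iff {𝒜 : ℤ → Submodule k H} {ℳ : ℤ → AddSubgroup M}
    {ζ : Fin 0 → H} {n : Fin 0 → ℤ} {d : Fin 1 → ℤ} :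
    IsRegularOfType 𝒜 ℳ ζ n d ↔ ∀ j, d 0 < j → ∀ m ∈ ℳ j, m = 0 := by
  constructor
  · intro h j hj m hm
    have := h.vanishing j (by simpa [prefixSum_zero] using hj) m hm
    simpa [prefixSubmodule_zero] using this
  · intro h
    refine ⟨fun i => i.elim0, fun i => i.elim0, fun i => i.elim0, fun j hj m hm => ?_⟩
    rw [h j (by simpa [prefixSum_zero] using hj) m hm]
    exact zero_mem _

/-- A sequence is filter-regular if and only if its first element is so and the remaining ones are
so for the quotient. -/
theorem isRegularOfType_succ_iff {𝒜 : ℤ → Submodule k H} {ℳ : ℤ → AddSubgroup M}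
    {ζ : Fin (r + 1) → H} {n : Fin (r + 1) → ℤ} {d : Fin (r + 2) → ℤ} :
    IsRegularOfType 𝒜 ℳ ζ n d ↔ 0 < n 0 ∧ ζ 0 ∈ 𝒜 (n 0) ∧
      (∀ j, d 0 < j → ∀ m ∈ ℳ j, ζ 0 • m = 0 → m = 0) ∧
      IsRegularOfType 𝒜 (quotientGrading ℳ (mulSubmodule M (ζ 0))) (Fin.tail ζ) (Fin.tail n)
        (fun i => n 0 + d i.succ) := by
  constructor
  · intro h
    refine ⟨h.pos 0, h.homogeneous 0, fun j hj m hm hm0 => ?_, fun i => h.pos i.succ,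
      fun i => h.homogeneous i.succ, ?_, ?_⟩
    · have := h.injective 0 j (by simpa [prefixSum_zero] using hj) m hm
      simpa [prefixSubmodule_zero, hm0] using this
    · rintro i j hj _ ⟨m, hm, rfl⟩ hm'
      refine (mkQ_mem_prefixSubmodule_tail ζ i m).2 (h.injective i.succ j ?_ m hm ?_)
      · rw [Fin.val_succ, prefixSum_succ, ← Fin.succ_castSucc]
        linarith
      · exact (mkQ_mem_prefixSubmodule_tail ζ i _).1 hm'
    · rintro j hj _ ⟨m, hm, rfl⟩
      refine (mkQ_mem_prefixSubmodule_tail ζ r m).2 (h.vanishing j ?_ m hm)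
      rw [prefixSum_succ, ← Fin.succ_last]
      linarith
  · rintro ⟨h1, h2, h3, h4⟩
    refine ⟨Fin.cases h1 h4.pos, Fin.cases h2 h4.homogeneous, ?_, ?_⟩
    · intro i
      refine Fin.cases (fun j hj m hm hm' => ?_) (fun i j hj m hm hm' => ?_) i
      · simp only [Fin.val_zero, prefixSubmodule_zero, Submodule.mem_bot] at hm' ⊢
        exact h3 j (by simpa [prefixSum_zero] using hj) m hm hm'
      · refine (mkQ_mem_prefixSubmodule_tail ζ i m).1 (h4.injective i j ?_ _ ⟨m, hm, rfl⟩ ?_)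
        · rw [Fin.val_succ, prefixSum_succ, ← Fin.succ_castSucc] at hj
          linarith
        · exact (mkQ_mem_prefixSubmodule_tail ζ i (ζ i.succ • m)).2 hm'
    · intro j hj m hm
      refine (mkQ_mem_prefixSubmodule_tail ζ r m).1 (h4.vanishing j ?_ _ ⟨m, hm, rfl⟩)
      rw [prefixSum_succ, ← Fin.succ_last] at hj
      linarith

variable {𝒜 : ℤ → Submodule k H} [GradedAlgebra 𝒜] {s : ℕ} {x : Fin s → H}

/-- If `M` has a filter-regular sequence of type `d`, then `Hⁱ(M)` vanishes in degrees `> dᵢ` for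
`i ≤ r`, and in all degrees for `i > r`. -/
theorem IsRegularOfType.vanishes (hH : IsConnectedGradedCommutative 𝒜)
    {e : Fin s → ℤ} (he : ∀ l, x l ∈ 𝒜 (e l)) (hpos : ∀ l, 0 < e l)
    (hx : Algebra.adjoin k (Set.range x) = ⊤) {M : Type w} [AddCommGroup M] [Module H M]
    {ℳ : ℤ → AddSubgroup M} [DirectSum.Decomposition ℳ] [SetLike.GradedSMul 𝒜 ℳ]
    {ζ : Fin r → H} {n : Fin r → ℤ} {d : Fin (r + 1) → ℤ} (h : IsRegularOfType 𝒜 ℳ ζ n d) :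
    (∀ (i : Fin (r + 1)) (j : ℤ), d i < j → Vanishes 𝒜 ℳ x (i : ℕ) j) ∧
      ∀ (i : ℕ) (j : ℤ), r < i → Vanishes 𝒜 ℳ x i j := by
  induction r generalizing M with
  | zero =>
    rw [isRegularOfType_zero_iff] at h
    refine ⟨fun i j hj => ?_, fun i j hi => vanishes_of_bounded hH he hpos h (by omega) j⟩
    obtain rfl : i = 0 := Fin.fin_one_eq_zero i
    exact vanishes_zero_of_eq_zero hH (h j hj)
  | succ r ih =>
    obtain ⟨h1, h2, h3, h4⟩ := isRegularOfType_succ_iff.1 h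
    let _ := (quotientGrading_isInternal ℳ (mulSubmodule M (ζ 0))
      (decompose_mem_mulSubmodule hH h2)).chooseDecomposition
    obtain ⟨ih1, ih2⟩ := ih h4
    have hK : HasBoundedKernel ℳ (ζ 0) := ⟨_, h3⟩
    have step : ∀ (i : ℕ) (D : ℤ), (∀ j, D < j →
        Vanishes 𝒜 (quotientGrading ℳ (mulSubmodule M (ζ 0))) x i (j + n 0)) →
        ∀ j, D < j → Vanishes 𝒜 ℳ x (i + 1 : ℕ) j := by
      intro i D hD j hj
      refine vanishes_of_smulHom_injective hH he hx h1 h2 (fun j hj c hc hc' => ?_) hj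
      refine mem_coboundaries_of_smulHom_mem hH he hpos h2 hK (by omega) ?_ hc hc'
      simpa using hD j hj
    constructor
    · intro i
      refine Fin.cases (fun j hj => ?_) (fun i j hj => ?_) i
      · exact vanishes_zero_of_injective hH he hx h1 h2 h3 hj
      · exact step i (d i.succ) (fun j hj => ih1 i _ (by linarith)) j hj
    · intro i j hi
      obtain ⟨i, rfl⟩ := Nat.exists_eq_add_of_lt hi
      exact step (r + 1 + i) (j - 1) (fun j _ => ih2 _ _ (by omega)) j (by omega)

/-- If `Hⁱ(M)` vanishes in degrees `> dᵢ` for `i ≤ r`, then every filter-regular sequence of length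
`r` has type `d`. -/
theorem IsRegularOfType.of_vanishes (hH : IsConnectedGradedCommutative 𝒜)
    {e : Fin s → ℤ} (he : ∀ l, x l ∈ 𝒜 (e l)) (hpos : ∀ l, 0 < e l)
    {M : Type w} [AddCommGroup M] [Module H M]
    {ℳ : ℤ → AddSubgroup M} [DirectSum.Decomposition ℳ] [SetLike.GradedSMul 𝒜 ℳ]
    {ζ : Fin r → H} {n : Fin r → ℤ} {d d' : Fin (r + 1) → ℤ} (h : IsRegularOfType 𝒜 ℳ ζ n d')
    (hd : IsTypeSequence d)
    (hV : ∀ (i : Fin (r + 1)) (j : ℤ), d i < j → Vanishes 𝒜 ℳ x (i : ℕ) j) :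
    IsRegularOfType 𝒜 ℳ ζ n d := by
  induction r generalizing M with
  | zero =>
    rw [isRegularOfType_zero_iff] at h ⊢
    intro j hj m hm
    -- Since `M` is bounded above, so is the kernel `M` of multiplication by `0`, which is torsion.
    exact eq_zero_of_vanishes_zero hH he (hV 0 j hj) hm fun l =>
      (eventually_centralSq_smul_eq_zero hH he hpos (a := 0)
        ⟨_, fun j hj m hm _ => h j hj m hm⟩ l hm (zero_smul H m)).exists
  | succ r ih =>
    obtain ⟨h1, h2, h3, h4⟩ := isRegularOfType_succ_iff.1 h
    let _ := (quotientGrading_isInternal ℳ (mulSubmodule M (ζ 0))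
      (decompose_mem_mulSubmodule hH h2)).chooseDecomposition
    have hK : HasBoundedKernel ℳ (ζ 0) := ⟨_, h3⟩
    refine isRegularOfType_succ_iff.2 ⟨h1, h2, fun j hj m hm ham => ?_, ih h4 ?_ ?_⟩
    · exact eq_zero_of_vanishes_zero hH he (hV 0 j hj) hm fun l =>
        (eventually_centralSq_smul_eq_zero hH he hpos hK l hm ham).exists
    · intro i
      have := hd i.succ
      rw [← Fin.succ_castSucc] at this
      constructor <;> linarith [this.1, this.2]
    · intro i j hj
      have h5 := (hd i).1
      -- The condition on types and `n 0 ≥ 1` give `d i ≤ d (i + 1) + n 0 < j`.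
      have h6 : Vanishes 𝒜 ℳ x (i : ℕ) (j - n 0 + n 0) := by
        rw [sub_add_cancel]
        exact hV i.castSucc j (by linarith)
      have h7 : Vanishes 𝒜 ℳ x ((i : ℕ) + 1) (j - n 0) := by
        have := hV i.succ (j - n 0) (by linarith)
        simpa using this
      have := vanishes_quotient hH he hpos h2 hK (by omega) h6 h7
      rwa [sub_add_cancel] at this

end RegularSequences

/-! ### Modules bounded above -/

section Bounds

open DirectSum Filter

variable {k : Type u} [Field k] {H : Type v} [Ring H] [Algebra k H]
variable {𝒜 : ℤ → Submodule k H} [GradedAlgebra 𝒜] {s : ℕ} {x : Fin s → H}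
variable {M : Type w} [AddCommGroup M] [Module H M] {ℳ : ℤ → AddSubgroup M}
  [DirectSum.Decomposition ℳ] [SetLike.GradedSMul 𝒜 ℳ]

/-- If powers of the generators annihilate `m`, then `Hm` is bounded above. -/
theorem exists_bound_of_torsion (hH : IsConnectedGradedCommutative 𝒜)
    (hx : Algebra.adjoin k (Set.range x) = ⊤) {e : Fin s → ℤ} (he : ∀ l, x l ∈ 𝒜 (e l))
    {N : ℕ} {m : M} (hm : ∀ l, (x l ^ 2) ^ N • m = 0) :
    ∃ B : ℤ, ∀ (a : H) (j : ℤ), B < j → (decompose ℳ (a • m) j : M) = 0 := by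
  classical
  obtain ⟨D₀, hD₀⟩ := exists_eq_sum_mul_sq_pow hH hx he N
  have h1 : ∀ q : ℤ, ∀ l, (x l ^ 2) ^ N • (decompose ℳ m q : M) = 0 := by
    intro q l
    have hp : (x l ^ 2) ^ N ∈ 𝒜 (N • 2 • e l) :=
      SetLike.pow_mem_graded N (SetLike.pow_mem_graded 2 (he l))
    rw [← coe_decompose_smul hp m q _ rfl, hm l]
    simp
  obtain ⟨B, hB⟩ : ∃ B : ℤ, ∀ q ∈ (decompose ℳ m).support, q ≤ B :=
    ⟨∑ q ∈ (decompose ℳ m).support, |q|, fun q hq => (le_abs_self q).trans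
      (Finset.single_le_sum (f := fun q : ℤ => |q|) (fun _ _ => abs_nonneg _) hq)⟩
  refine ⟨D₀ + B, fun a j hj => ?_⟩
  rw [← DirectSum.sum_support_decompose ℳ m, Finset.smul_sum, decompose_sum,
    DFinsupp.finsetSum_apply, AddSubmonoidClass.coe_finsetSum]
  refine Finset.sum_eq_zero fun q hq => ?_
  induction a using DirectSum.Decomposition.inductionOn 𝒜 with
  | zero => simp
  | @homogeneous p a =>
    by_cases hpq : p + q = j
    · obtain ⟨h, -, hh⟩ := hD₀ p (by linarith [hB q hq]) a a.2
      have : (a : H) • (decompose ℳ m q : M) = 0 := by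
        rw [hh, Finset.sum_smul]
        exact Finset.sum_eq_zero fun l _ => by rw [mul_smul, h1, smul_zero]
      rw [this]
      simp
    · exact decompose_of_mem_ne ℳ (smul_mem_degree a.2 (SetLike.coe_mem _) rfl) hpq
  | add a b ha hb => simp [add_smul, ha, hb]

/-- A finitely generated submodule annihilated by powers of the generators of `H` is bounded
above. -/
theorem exists_bound_of_fg_of_torsion (hH : IsConnectedGradedCommutative 𝒜)
    (hx : Algebra.adjoin k (Set.range x) = ⊤) {e : Fin s → ℤ} (he : ∀ l, x l ∈ 𝒜 (e l))
    {K : Submodule H M} (hK : K.FG) {N : ℕ} (hm : ∀ l, ∀ m ∈ K, (x l ^ 2) ^ N • m = 0) :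
    ∃ B : ℤ, ∀ j, B < j → ∀ m ∈ ℳ j, m ∈ K → m = 0 := by
  obtain ⟨G, hG⟩ := hK
  have h1 : ∀ g ∈ G, ∃ B : ℤ, ∀ (a : H) (j : ℤ), B < j → (decompose ℳ (a • g) j : M) = 0 :=
    fun g hg => exists_bound_of_torsion hH hx he fun l => hm l g (hG ▸ Submodule.subset_span hg)
  choose! B hB using h1
  refine ⟨∑ g ∈ G, |B g|, fun j hj m hmj hmK => ?_⟩
  have h2 : ∀ a : H, (decompose ℳ (a • m) j : M) = 0 := by
    rw [← hG] at hmK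
    clear hmj
    induction hmK using Submodule.span_induction with
    | mem g hg =>
      exact fun a => hB g hg a j (lt_of_le_of_lt ((le_abs_self _).trans
        (Finset.single_le_sum (f := fun g => |B g|) (fun _ _ => abs_nonneg _) hg)) hj)
    | zero => simp
    | add y z _ _ hy hz => intro a; simp [smul_add, hy a, hz a]
    | smul b y _ hy => intro a; rw [smul_smul]; exact hy _
  simpa [decompose_of_mem_same ℳ hmj] using h2 1

theorem isHomogeneous_annihilator (𝒜 : ℤ → Submodule k H) [GradedAlgebra 𝒜] (ℳ : ℤ → AddSubgroup M)
    [DirectSum.Decomposition ℳ] [SetLike.GradedSMul 𝒜 ℳ] :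
    (Module.annihilator H M).IsHomogeneous 𝒜 := by
  classical
  intro d a ha
  rw [Module.mem_annihilator] at ha ⊢
  intro m
  induction m using DirectSum.Decomposition.inductionOn ℳ with
  | zero => simp
  | @homogeneous i m =>
    have h1 : ∀ b : H, (decompose ℳ (b • (m : M)) (d + i) : M) =
        (decompose 𝒜 b d : H) • (m : M) := by
      intro b
      induction b using DirectSum.Decomposition.inductionOn 𝒜 with
      | zero => simp
      | @homogeneous p b =>
        have h2 : (b : H) • (m : M) ∈ ℳ (p + i) :=
          smul_mem_degree b.2 m.2 rfl
        by_cases hp : p = d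
        · subst hp
          rw [decompose_of_mem_same _ h2, decompose_of_mem_same _ b.2]
        · rw [decompose_of_mem_ne _ h2 (by omega), decompose_of_mem_ne _ b.2 hp, zero_smul]
      | add b b' hb hb' => simp [add_smul, hb, hb']
    rw [← h1 a, ha]
    simp
  | add m m' h h' => rw [smul_add, h, h', add_zero]

end Bounds

section Bounded

variable {k : Type u} [Field k] {H : Type v} [Ring H] [Algebra k H] {𝒜 : ℤ → Submodule k H}
variable {M : Type w} [AddCommGroup M] [Module H M] {ℳ : ℤ → AddSubgroup M} {r : ℕ}

theorem IsRegularOfType.mono {ζ : Fin r → H} {n : Fin r → ℤ} {d d' : Fin (r + 1) → ℤ}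
    (h : IsRegularOfType 𝒜 ℳ ζ n d) (hd : ∀ i, d i ≤ d' i) : IsRegularOfType 𝒜 ℳ ζ n d' :=
  ⟨h.pos, h.homogeneous, fun i j hj => h.injective i j (by linarith [hd i.castSucc]),
    fun j hj => h.vanishing j (by linarith [hd (Fin.last r)])⟩

/-- On a module which is bounded above, the zero sequence is filter-regular; `0` is homogeneous of
every degree, in particular of degree `1`. -/
theorem isRegularOfType_zero_of_bounded {B : ℤ} (hB : ∀ j, B < j → ∀ m ∈ ℳ j, m = 0) :
    IsRegularOfType 𝒜 ℳ (0 : Fin r → H) (fun _ => 1) (fun _ => B) := by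
  have h1 : ∀ i, 0 ≤ prefixSum (fun _ : Fin r => (1 : ℤ)) i :=
    fun i => Finset.sum_nonneg fun _ _ => zero_le_one
  refine ⟨fun _ => one_pos, fun _ => zero_mem _, fun i j hj m hm _ => ?_, fun j hj m hm => ?_⟩
  · rw [hB j (by linarith [h1 i]) m hm]
    exact zero_mem _
  · rw [hB j (by linarith [h1 r]) m hm]
    exact zero_mem _

end Bounded

/-! ### Homogeneous prime avoidance -/

section PrimeAvoidance

variable {R : Type u} [CommRing R] {k : Type v} [Field k] [Algebra k R] (𝒜 : ℤ → Submodule k R)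
  [GradedAlgebra 𝒜]

/-- Homogeneous prime avoidance: a homogeneous element of positive degree outside finitely many
homogeneous primes. -/
theorem exists_homogeneous_notMem (S : Finset (Ideal R))
    (hS : ∀ P ∈ S, P.IsPrime ∧ P.IsHomogeneous 𝒜 ∧ ∃ d : ℤ, 0 < d ∧ ∃ t ∈ 𝒜 d, t ∉ P) :
    ∃ d : ℤ, 0 < d ∧ ∃ f ∈ 𝒜 d, ∀ P ∈ S, f ∉ P := by
  classical
  induction hn : S.card using Nat.strong_induction_on generalizing S with
  | _ n ih =>
  rcases S.eq_empty_or_nonempty with rfl | ⟨P, hP⟩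
  · exact ⟨1, one_pos, 0, zero_mem _, by simp⟩
  -- Primes inside `P` are avoided together with `P`.
  let T := S.filter fun Q => ¬ Q ≤ P
  have hTS : T ⊆ S := Finset.filter_subset _ _
  have hcard : T.card < n := by
    rw [← hn]
    exact Finset.card_lt_card ((Finset.filter_ssubset).2 ⟨P, hP, by simp⟩)
  obtain ⟨d, hd, f, hf, hfT⟩ := ih _ hcard T (fun Q hQ => hS Q (hTS hQ)) rfl
  suffices h : ∃ d : ℤ, 0 < d ∧ ∃ f ∈ 𝒜 d, f ∉ P ∧ ∀ Q ∈ T, f ∉ Q by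
    obtain ⟨d, hd, f, hf, hfP, hfT⟩ := h
    refine ⟨d, hd, f, hf, fun Q hQ => ?_⟩
    by_cases hQP : Q ≤ P
    · exact fun h => hfP (hQP h)
    · exact hfT Q (Finset.mem_filter.2 ⟨hQ, hQP⟩)
  by_cases hfP : f ∉ P
  · exact ⟨d, hd, f, hf, hfP, hfT⟩
  rw [not_not] at hfP
  obtain ⟨hPprime, -, d₁, hd₁, t, ht, htP⟩ := hS P hP
  -- A homogeneous element of all primes in `T` which is not in `P`.
  have h1 : ∀ Q ∈ T, ∃ (q : ℤ) (g : R), g ∈ 𝒜 q ∧ g ∈ Q ∧ g ∉ P := by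
    intro Q hQ
    obtain ⟨a, haQ, haP⟩ := Set.not_subset.1 (Finset.mem_filter.1 hQ).2
    by_contra! h
    refine haP ?_
    rw [← DirectSum.sum_support_decompose 𝒜 a]
    exact sum_mem fun q _ => h q _ (SetLike.coe_mem _) ((hS Q (hTS hQ)).2.1 q haQ)
  choose! q g hgq hgQ hgP using h1
  -- A power of `t` makes the degree of the product positive.
  let N := (1 + ∑ Q ∈ T, |q Q|).toNat
  have h2 : t ^ N * ∏ Q ∈ T, g Q ∈ 𝒜 (N • d₁ + ∑ Q ∈ T, q Q) :=
    SetLike.GradedMul.mul_mem (SetLike.pow_mem_graded N ht)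
      (SetLike.prod_mem_graded _ _ _ hgq)
  set c := t ^ N * ∏ Q ∈ T, g Q with hc
  set dc := N • d₁ + ∑ Q ∈ T, q Q with hdc
  have hdc0 : 0 < dc := by
    have h3 : -(∑ Q ∈ T, |q Q|) ≤ ∑ Q ∈ T, q Q := by
      rw [← Finset.sum_neg_distrib]
      exact Finset.sum_le_sum fun Q _ => neg_abs_le _
    have h4 : 1 + ∑ Q ∈ T, |q Q| ≤ N := Int.self_le_toNat _
    have h5 : (N : ℤ) ≤ N * d₁ := le_mul_of_one_le_right (by omega) (by omega)
    rw [hdc, nsmul_eq_mul]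
    linarith
  have hcP : c ∉ P := by
    intro h
    rcases hPprime.mem_or_mem h with h | h
    · exact htP (hPprime.mem_of_pow_mem _ h)
    · obtain ⟨Q, hQ, h⟩ := (hPprime.prod_mem_iff).1 h
      exact hgP Q hQ h
  have hcT : ∀ Q ∈ T, c ∈ Q := fun Q hQ =>
    Ideal.mul_mem_left _ _ (Ideal.mem_of_dvd _ (Finset.dvd_prod_of_mem g hQ) (hgQ Q hQ))
  have hd' : (d.toNat : ℤ) = d := Int.toNat_of_nonneg hd.le
  have hdc' : (dc.toNat : ℤ) = dc := Int.toNat_of_nonneg hdc0.le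
  have hfd : f ^ dc.toNat ∈ 𝒜 (dc * d) := by
    have := SetLike.pow_mem_graded dc.toNat hf
    rwa [nsmul_eq_mul, hdc'] at this
  have hcd : c ^ d.toNat ∈ 𝒜 (dc * d) := by
    have := SetLike.pow_mem_graded d.toNat h2
    rwa [nsmul_eq_mul, hd', mul_comm] at this
  -- Raised to suitable powers, `f` and `c` have the same degree, and their sum avoids `P` and `T`.
  refine ⟨dc * d, mul_pos hdc0 hd, f ^ dc.toNat + c ^ d.toNat, add_mem hfd hcd, ?_, ?_⟩
  · rw [P.add_mem_iff_right (Ideal.pow_mem_of_mem _ hfP _ (by omega))]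
    exact fun h => hcP (hPprime.mem_of_pow_mem _ h)
  · intro Q hQ
    rw [Q.add_mem_iff_left (Ideal.pow_mem_of_mem _ (hcT Q hQ) _ (by omega))]
    exact fun h => hfT Q hQ ((hS Q (hTS hQ)).1.mem_of_pow_mem _ h)

end PrimeAvoidance

/-! ### Graded polynomial rings -/

section Polynomial

open DirectSum MvPolynomial

variable {k : Type u} [Field k] {s : ℕ}

attribute [local instance] MvPolynomial.weightedGradedAlgebra

/-- A polynomial ring whose variables have even positive degrees is connected and graded
commutative. -/
theorem isConnectedGradedCommutative_mvPolynomial {w : Fin s → ℤ} (hw : ∀ l, 0 < w l)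
    (hw' : ∀ l, Even (w l)) :
    IsConnectedGradedCommutative (weightedHomogeneousSubmodule k w) where
  algebraMap_injective := MvPolynomial.C_injective _ _
  degree_zero a ha := by
    refine ⟨coeff 0 a, ?_⟩
    ext m
    rw [algebraMap_eq, coeff_C]
    split_ifs with h
    · rw [h]
    · by_contra hm
      have h1 := ha (Ne.symm hm)
      rw [Finsupp.weight_apply, Finsupp.sum,
        Finset.sum_eq_zero_iff_of_nonneg (fun l _ => nsmul_nonneg (hw l).le _)] at h1
      obtain ⟨l, hl⟩ := Finsupp.support_nonempty_iff.2 (Ne.symm h)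
      have h2 := h1 l hl
      rw [smul_eq_zero] at h2
      rcases h2 with h2 | h2
      · exact Finsupp.mem_support_iff.1 hl h2
      · exact (hw l).ne' h2
  graded_comm i j a b ha hb := by
    by_cases ha0 : a = 0
    · simp [ha0]
    have hi : Even i := by
      obtain ⟨m, hm⟩ := MvPolynomial.ne_zero_iff.1 ha0
      rw [← ha hm, Finsupp.weight_apply, Finsupp.sum]
      exact Finset.even_sum _ fun l _ => by simpa using (hw' l).mul_left _
    rw [Int.negOnePow_even _ (hi.mul_right j), one_smul, mul_comm]

/-- A proper homogeneous ideal is contained in every ideal containing the variables. -/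
theorem le_of_isHomogeneous_of_X_mem {w : Fin s → ℤ} (hw : ∀ l, 0 < w l)
    (hw' : ∀ l, Even (w l)) {Q P : Ideal (MvPolynomial (Fin s) k)}
    (hQ : Q.IsHomogeneous (weightedHomogeneousSubmodule k w)) (hQ' : Q ≠ ⊤)
    (hP : ∀ l, X l ∈ P) : Q ≤ P := by
  classical
  intro q hq
  rw [← DirectSum.sum_support_decompose (weightedHomogeneousSubmodule k w) q]
  refine sum_mem fun d _ => ?_
  have h1 := hQ d hq
  have h2 := SetLike.coe_mem (decompose (weightedHomogeneousSubmodule k w) q d)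
  generalize (decompose (weightedHomogeneousSubmodule k w) q d : MvPolynomial (Fin s) k) = p
    at h1 h2
  by_cases hp : coeff 0 p = 0
  · rw [p.as_sum]
    refine sum_mem fun m hm => ?_
    obtain ⟨l, hl⟩ : ∃ l, m l ≠ 0 := by
      by_contra! h
      obtain rfl : m = 0 := Finsupp.ext h
      exact mem_support_iff.1 hm hp
    exact Ideal.mem_of_dvd _ (MvPolynomial.X_dvd_monomial.2 (Or.inr hl)) (hP l)
  · exfalso
    have hd : d = 0 := by simpa using (h2 hp).symm
    subst hd
    obtain ⟨c, rfl⟩ := (isConnectedGradedCommutative_mvPolynomial hw hw').degree_zero p h2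
    refine hQ' (Ideal.eq_top_of_isUnit_mem _ h1 (IsUnit.map _ (IsUnit.mk0 c ?_)))
    rintro rfl
    simp at hp

end Polynomial

/-! ### Existence of filter-regular sequences over a polynomial ring -/

section Existence

open DirectSum MvPolynomial
open scoped Pointwise

attribute [local instance] MvPolynomial.weightedGradedAlgebra

/-- An element of all associated primes of a finitely generated module acts nilpotently. -/
theorem exists_pow_smul_eq_zero {R : Type u} [CommRing R] [IsNoetherianRing R] {M : Type w}
    [AddCommGroup M] [Module R M] [Module.Finite R M] {y : R}
    (hy : ∀ P ∈ associatedPrimes R M, y ∈ P) : ∃ n : ℕ, ∀ m : M, y ^ n • m = 0 := by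
  have h : y ∈ (Module.annihilator R M).radical := by
    rw [← Ideal.sInf_minimalPrimes, Ideal.mem_sInf]
    exact fun {P} hP => hy P
      (Module.associatedPrimes.minimalPrimes_annihilator_subset_associatedPrimes R M hP)
  obtain ⟨n, hn⟩ := h
  exact ⟨n, Module.mem_annihilator.1 hn⟩

theorem mulSubmodule_eq_smul_top {R : Type u} [CommRing R] {M : Type w}
    [AddCommGroup M] [Module R M] (a : R) :
    a • (⊤ : Submodule R M) = mulSubmodule M a := by
  ext y
  rw [Submodule.mem_smul_pointwise_iff_exists]
  constructor
  · rintro ⟨m, -, rfl⟩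
    exact Submodule.subset_span ⟨m, rfl⟩
  · intro h
    induction h using Submodule.span_induction with
    | mem y hy =>
      obtain ⟨m, rfl⟩ := hy
      exact ⟨m, trivial, rfl⟩
    | zero => exact ⟨0, trivial, by simp⟩
    | add y z _ _ hy hz =>
      obtain ⟨m, -, rfl⟩ := hy
      obtain ⟨m', -, rfl⟩ := hz
      exact ⟨m + m', trivial, by simp⟩
    | smul b y _ hy =>
      obtain ⟨m, -, rfl⟩ := hy
      exact ⟨b • m, trivial, smul_comm _ _ _⟩

variable {k : Type u} [Field k] {s : ℕ} {w : Fin s → ℤ}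

theorem X_mem_degree (l : Fin s) :
    (X l : MvPolynomial (Fin s) k) ∈ weightedHomogeneousSubmodule k w (w l) :=
  isWeightedHomogeneous_X k w l

variable {M : Type v} [AddCommGroup M] [Module (MvPolynomial (Fin s) k) M]
  {ℳ : ℤ → AddSubgroup M} [DirectSum.Decomposition ℳ]
  [SetLike.GradedSMul (weightedHomogeneousSubmodule k w) ℳ]

/-- A submodule whose associated primes all contain the variables is bounded above. -/
theorem exists_bound_of_X_mem_associatedPrimes (hw : ∀ l, 0 < w l) (hw' : ∀ l, Even (w l))
    (K : Submodule (MvPolynomial (Fin s) k) M)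
    [Module.Finite (MvPolynomial (Fin s) k) K]
    (hK : ∀ P ∈ associatedPrimes (MvPolynomial (Fin s) k) K, ∀ l, X l ∈ P) :
    ∃ B : ℤ, ∀ j, B < j → ∀ m ∈ ℳ j, m ∈ K → m = 0 := by
  have h1 : ∀ l : Fin s, ∃ n : ℕ, ∀ m : K, (X l : MvPolynomial (Fin s) k) ^ n • m = 0 :=
    fun l => exists_pow_smul_eq_zero fun P hP => hK P hP l
  choose n hn using h1
  refine exists_bound_of_fg_of_torsion (isConnectedGradedCommutative_mvPolynomial hw hw')
    adjoin_range_X X_mem_degree (N := ∑ l, n l) (Module.Finite.iff_fg.1 inferInstance) ?_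
  intro l m hm
  have h2 : n l ≤ 2 * ∑ l, n l :=
    (Finset.single_le_sum (f := n) (fun _ _ => Nat.zero_le _) (Finset.mem_univ l)).trans (by omega)
  obtain ⟨c, hc⟩ := Nat.exists_eq_add_of_le h2
  have h3 := congrArg Subtype.val (hn l ⟨m, hm⟩)
  rw [← pow_mul, hc, add_comm, pow_add, mul_smul]
  exact (congrArg _ h3).trans (smul_zero _)

/-- The homogeneous core of a prime in the support lies in the support. -/
theorem annihilator_le_homogeneousCore (ℳ : ℤ → AddSubgroup M) [DirectSum.Decomposition ℳ]
    [SetLike.GradedSMul (weightedHomogeneousSubmodule k w) ℳ]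
    {P : Ideal (MvPolynomial (Fin s) k)} (hP : Module.annihilator _ M ≤ P) :
    Module.annihilator _ M ≤ (P.homogeneousCore (weightedHomogeneousSubmodule k w)).toIdeal := by
  intro a ha
  have h1 := (isHomogeneous_annihilator (weightedHomogeneousSubmodule k w)
    ℳ).toIdeal_homogeneousCore_eq_self
  rw [← h1] at ha
  exact Ideal.homogeneousCore_mono _ hP ha

/-- If the support contains a prime not containing all variables, then the dimension of `M` is
positive, and there is a homogeneous element `f` of positive degree whose kernel is bounded above
and which lowers the dimension. -/
theorem exists_hasBoundedKernel_of_relevant [Module.Finite (MvPolynomial (Fin s) k) M]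
    (hw : ∀ l, 0 < w l) (hw' : ∀ l, Even (w l)) {P₀ : Ideal (MvPolynomial (Fin s) k)}
    (hP₀ : P₀.IsPrime) (hP₀M : Module.annihilator _ M ≤ P₀) {l₀ : Fin s} (hl₀ : X l₀ ∉ P₀) :
    0 < Module.supportDim (MvPolynomial (Fin s) k) M ∧
    ∃ d : ℤ, 0 < d ∧ ∃ f ∈ weightedHomogeneousSubmodule k w d, HasBoundedKernel ℳ f ∧
      Module.supportDim (MvPolynomial (Fin s) k) (M ⧸ mulSubmodule M f) + 1 ≤
        Module.supportDim (MvPolynomial (Fin s) k) M := by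
  classical
  let 𝒲 := weightedHomogeneousSubmodule k w
  let Q := (P₀.homogeneousCore 𝒲).toIdeal
  have hQP : Q ≤ P₀ := Ideal.toIdeal_homogeneousCore_le 𝒲 P₀
  have hQ : Q.IsPrime := hP₀.homogeneousCore
  have hQhom : Q.IsHomogeneous 𝒲 := (P₀.homogeneousCore 𝒲).isHomogeneous
  have hQM : Module.annihilator _ M ≤ Q := annihilator_le_homogeneousCore ℳ hP₀M
  have hQle : ∀ P : Ideal (MvPolynomial (Fin s) k), (∀ l, X l ∈ P) → Q ≤ P := fun P hP =>
    le_of_isHomogeneous_of_X_mem hw hw' hQhom hQ.ne_top hP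
  -- A minimal prime containing all variables contains `Q`, hence equals `Q ≤ P₀`.
  have hmin : ∀ P ∈ (Module.annihilator (MvPolynomial (Fin s) k) M).minimalPrimes,
      ∃ l, X l ∉ P := by
    intro P hP
    by_contra! h
    exact hl₀ (hQP (hP.2 ⟨hQ, hQM⟩ (hQle P h) (h l₀)))
  constructor
  · let 𝔪 : Ideal (MvPolynomial (Fin s) k) := RingHom.ker (constantCoeff (σ := Fin s) (R := k))
    have h𝔪 : 𝔪.IsPrime := RingHom.ker_isPrime _
    have hX : ∀ l, X l ∈ 𝔪 := fun l => by simp [𝔪, RingHom.mem_ker]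
    refine Order.krullDim_pos_iff.2 ⟨⟨⟨Q, hQ⟩, Module.mem_support_iff_of_finite.2 hQM⟩,
      ⟨⟨𝔪, h𝔪⟩, Module.mem_support_iff_of_finite.2 (hQM.trans (hQle _ hX))⟩, ?_⟩
    refine lt_of_le_not_ge (hQle _ hX) fun h => hl₀ (hQP (h (hX l₀)))
  · have hfin := associatedPrimes.finite (MvPolynomial (Fin s) k) M
    -- Associated primes are replaced by their homogeneous cores, which contain the same homogeneous
    -- elements.
    let S : Finset (Ideal (MvPolynomial (Fin s) k)) :=
      (hfin.toFinset.filter fun P => ∃ l, X l ∉ P).image fun P => (P.homogeneousCore 𝒲).toIdeal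
    have hS : ∀ P ∈ S, P.IsPrime ∧ P.IsHomogeneous 𝒲 ∧ ∃ d : ℤ, 0 < d ∧ ∃ t ∈ 𝒲 d, t ∉ P := by
      intro P hP
      obtain ⟨P, hP', rfl⟩ := Finset.mem_image.1 hP
      obtain ⟨hP, l, hl⟩ := Finset.mem_filter.1 hP'
      exact ⟨(IsAssociatedPrime.isPrime (hfin.mem_toFinset.1 hP)).homogeneousCore,
        (P.homogeneousCore 𝒲).isHomogeneous, w l, hw l, X l, X_mem_degree l,
        fun h => hl (Ideal.toIdeal_homogeneousCore_le 𝒲 P h)⟩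
    obtain ⟨d, hd, f, hf, hfS⟩ := exists_homogeneous_notMem 𝒲 S hS
    have hfP : ∀ P ∈ associatedPrimes (MvPolynomial (Fin s) k) M, f ∈ P → ∀ l, X l ∈ P := by
      intro P hP hfP
      by_contra! h
      exact hfS _ (Finset.mem_image.2
        ⟨P, Finset.mem_filter.2 ⟨hfin.mem_toFinset.2 hP, h⟩, rfl⟩)
        (Ideal.mem_homogeneousCore_of_homogeneous_of_mem ⟨d, hf⟩ hfP)
    refine ⟨d, hd, f, hf, ?_, ?_⟩
    · let K : Submodule (MvPolynomial (Fin s) k) M :=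
        LinearMap.ker (LinearMap.lsmul (MvPolynomial (Fin s) k) M f)
      have hK : ∀ P ∈ associatedPrimes (MvPolynomial (Fin s) k) K, ∀ l, X l ∈ P := by
        intro P hP
        refine hfP P (associatedPrimes.subset_of_injective K.injective_subtype hP) ?_
        refine IsAssociatedPrime.annihilator_le hP ?_
        rw [Submodule.mem_annihilator]
        rintro ⟨m, hm⟩ -
        exact Subtype.ext hm
      obtain ⟨B, hB⟩ := exists_bound_of_X_mem_associatedPrimes (ℳ := ℳ) hw hw' K hK
      exact ⟨B, fun j hj m hm h => hB j hj m hm h⟩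
    · rw [← Module.supportDim_eq_of_equiv (Submodule.quotEquivOfEq _ _
        (mulSubmodule_eq_smul_top (M := M) f))]
      refine Module.supportDim_quotSMulTop_succ_le_of_notMem_minimalPrimes fun P hP h => ?_
      obtain ⟨l, hl⟩ := hmin P hP
      exact hl (hfP P (Module.associatedPrimes.minimalPrimes_annihilator_subset_associatedPrimes
        _ M hP) h l)

/-- A finitely generated graded module of dimension at most `r` over a graded polynomial ring has a
filter-regular sequence of length `r`. -/
theorem exists_isRegularOfType (hw : ∀ l, 0 < w l) (hw' : ∀ l, Even (w l)) (r : ℕ)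
    {M : Type v} [AddCommGroup M] [Module (MvPolynomial (Fin s) k) M]
    [Module.Finite (MvPolynomial (Fin s) k) M]
    (ℳ : ℤ → AddSubgroup M) [DirectSum.Decomposition ℳ]
    [SetLike.GradedSMul (weightedHomogeneousSubmodule k w) ℳ]
    (hr : Module.supportDim (MvPolynomial (Fin s) k) M ≤ r) :
    ∃ (ζ : Fin r → MvPolynomial (Fin s) k) (n : Fin r → ℤ) (d : Fin (r + 1) → ℤ),
      IsRegularOfType (weightedHomogeneousSubmodule k w) ℳ ζ n d := by
  induction r generalizing M with
  | zero =>
    by_cases h : ∀ P : Ideal (MvPolynomial (Fin s) k), P.IsPrime → Module.annihilator _ M ≤ P →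
      ∀ l, X l ∈ P
    · obtain ⟨B, hB⟩ := exists_bound_of_X_mem_associatedPrimes (ℳ := ℳ) hw hw' ⊤ fun P hP =>
        h P (IsAssociatedPrime.isPrime hP) (IsAssociatedPrime.annihilator_le
          (associatedPrimes.subset_of_injective (Submodule.injective_subtype _) hP) |>.trans' <|
            by rw [Submodule.annihilator_top])
      exact ⟨_, _, _, isRegularOfType_zero_of_bounded fun j hj m hm => hB j hj m hm trivial⟩
    · push Not at h
      obtain ⟨P, hP, hPM, l, hl⟩ := h
      have := (exists_hasBoundedKernel_of_relevant (ℳ := ℳ) hw hw' hP hPM hl).1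
      exact absurd (this.trans_le hr) (lt_irrefl _)
  | succ r ih =>
    by_cases h : ∀ P : Ideal (MvPolynomial (Fin s) k), P.IsPrime → Module.annihilator _ M ≤ P →
      ∀ l, X l ∈ P
    · obtain ⟨B, hB⟩ := exists_bound_of_X_mem_associatedPrimes (ℳ := ℳ) hw hw' ⊤ fun P hP =>
        h P (IsAssociatedPrime.isPrime hP) (IsAssociatedPrime.annihilator_le
          (associatedPrimes.subset_of_injective (Submodule.injective_subtype _) hP) |>.trans' <|
            by rw [Submodule.annihilator_top])
      exact ⟨_, _, _, isRegularOfType_zero_of_bounded fun j hj m hm => hB j hj m hm trivial⟩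
    · push Not at h
      obtain ⟨P, hP, hPM, l, hl⟩ := h
      obtain ⟨-, d₀, hd₀, f, hf, ⟨B, hB⟩, hdim⟩ :=
        exists_hasBoundedKernel_of_relevant (ℳ := ℳ) hw hw' hP hPM hl
      let _ := (quotientGrading_isInternal ℳ (mulSubmodule M f)
        (decompose_mem_mulSubmodule (isConnectedGradedCommutative_mvPolynomial hw hw')
          hf)).chooseDecomposition
      obtain ⟨ζ, n, d, hreg⟩ := ih (quotientGrading ℳ (mulSubmodule M f))
        (ENat.WithBot.add_le_add_natCast_right_iff.mp (hdim.trans hr))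
      refine ⟨Fin.cons f ζ, Fin.cons d₀ n, Fin.cons B fun i => d i - d₀,
        isRegularOfType_succ_iff.2 ⟨hd₀, hf, hB, ?_⟩⟩
      exact hreg.mono fun i => by simp

end Existence

/-! ### Comparison of dimensions -/

section Commutators

variable {H : Type v} [Ring H]

theorem isTwoSided_span_of_center {T : Set H} (hT : ∀ c ∈ T, c ∈ Subring.center H) :
    (Ideal.span T).IsTwoSided := by
  refine ⟨fun {a} b ha => ?_⟩
  induction ha using Submodule.span_induction with
  | mem c hc =>
    rw [← Subring.mem_center_iff.1 (hT c hc) b]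
    exact Ideal.mul_mem_left _ _ (Ideal.subset_span hc)
  | zero => simp
  | add y z _ _ hy hz => rw [add_mul]; exact add_mem hy hz
  | smul h y _ hy => rw [smul_eq_mul, mul_assoc]; exact Ideal.mul_mem_left _ _ hy

theorem isTwoSided_sup {I J : Ideal H} (hI : I.IsTwoSided) (hJ : J.IsTwoSided) :
    (I ⊔ J).IsTwoSided := by
  refine ⟨fun {a} b ha => ?_⟩
  obtain ⟨i, hi, j, hj, rfl⟩ := Submodule.mem_sup.1 ha
  rw [add_mul]
  exact Submodule.add_mem_sup (hI.mul_mem_of_left b hi) (hJ.mul_mem_of_left b hj)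

/-- An ideal generated by central elements of square zero is nil. -/
theorem exists_pow_mem_of_mem_sup_span {I : Ideal H} [hI : I.IsTwoSided] {T : Set H}
    (hT : ∀ c ∈ T, c ∈ Subring.center H) (hT' : ∀ c ∈ T, c * c = 0) {a : H}
    (ha : a ∈ I ⊔ Ideal.span T) : ∃ N : ℕ, a ^ N ∈ I := by
  classical
  have key : ∀ F : Finset H, (F : Set H) ⊆ T → ∀ a ∈ I ⊔ Ideal.span (F : Set H),
      ∃ N : ℕ, a ^ N ∈ I := by
    intro F
    induction F using Finset.induction_on with
    | empty =>
      intro _ a ha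
      exact ⟨1, by simpa using ha⟩
    | insert c F _ ih =>
      intro hF a ha
      rw [Finset.coe_insert, Set.insert_subset_iff] at hF
      rw [Finset.coe_insert, Ideal.span_insert, sup_left_comm, sup_comm] at ha
      obtain ⟨g, hg, t, ht, rfl⟩ := Submodule.mem_sup.1 ha
      obtain ⟨h, rfl⟩ := Submodule.mem_span_singleton.1 ht
      have hL := isTwoSided_sup hI
        (isTwoSided_span_of_center fun b hb => hT b (hF.2 hb))
      have hcc := hT' c hF.1
      have hc := Subring.mem_center_iff.1 (hT c hF.1)
      have hsq : (h • c) * (h • c) = 0 := by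
        rw [smul_eq_mul, mul_assoc, ← mul_assoc c, ← hc h, mul_assoc, hcc, mul_zero, mul_zero]
      obtain ⟨N, hN⟩ := ih hF.2 ((g + h • c) ^ 2) (by
        rw [pow_two, add_mul, mul_add (h • c), hsq, add_zero]
        exact add_mem (hL.mul_mem_of_left _ hg) (Ideal.mul_mem_left _ _ hg))
      exact ⟨2 * N, by rwa [pow_mul]⟩
  obtain ⟨i, hi, t, ht, rfl⟩ := Submodule.mem_sup.1 ha
  obtain ⟨F, hF, htF⟩ := Submodule.mem_span_finite_of_mem_span ht
  exact key F hF _ (Submodule.add_mem_sup hi htF)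

variable {k : Type u} [Field k] [Algebra k H]

/-- The commutators of homogeneous elements. -/
def homogeneousCommutators (𝒜 : ℤ → Submodule k H) : Set H :=
  {c | ∃ (i j : ℤ) (a b : H), a ∈ 𝒜 i ∧ b ∈ 𝒜 j ∧ c = a * b - b * a}

variable {𝒜 : ℤ → Submodule k H} [GradedAlgebra 𝒜]

/-- Commutators of homogeneous elements are central and of square zero: they vanish unless both
elements have odd degree. -/
theorem commutator_mem_center (hH : IsConnectedGradedCommutative 𝒜) {c : H}
    (hc : c ∈ homogeneousCommutators 𝒜) : c ∈ Subring.center H ∧ c * c = 0 := by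
  obtain ⟨i, j, a, b, ha, hb, rfl⟩ := hc
  rcases Int.even_or_odd (i * j) with hij | hij
  · rw [hH.graded_comm i j a b ha hb, Int.negOnePow_even _ hij, one_smul, sub_self]
    exact ⟨zero_mem _, mul_zero _⟩
  · obtain ⟨hi, hj⟩ := Int.odd_mul.1 hij
    have hba : b * a = -(a * b) := by
      rw [hH.graded_comm i j a b ha hb, Int.negOnePow_odd _ hij]
      simp
    have hab : a * b ∈ Subring.center H :=
      hH.mem_center_of_even (hi.add_odd hj) (SetLike.GradedMul.mul_mem ha hb)
    have haa : a * a + a * a = 0 := by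
      have := hH.graded_comm i i a a ha ha
      rw [Int.negOnePow_odd _ (hi.mul hi)] at this
      nth_rw 1 [this]
      simp
    have hsq : (a * b) * (a * b) + (a * b) * (a * b) = 0 := by
      have h1 : (a * b) * (a * b) = -(a * a * (b * b)) := by
        rw [mul_assoc, ← mul_assoc b, hba]
        noncomm_ring
      rw [h1, ← neg_add, ← add_mul, haa, zero_mul, neg_zero]
    rw [hba, sub_neg_eq_add]
    refine ⟨add_mem hab hab, ?_⟩
    rw [mul_add, add_mul, hsq, add_zero]

theorem mul_comm_mem_span_homogeneousCommutators (a b : H) :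
    a * b - b * a ∈ Ideal.span (homogeneousCommutators 𝒜) := by
  induction a using DirectSum.Decomposition.inductionOn 𝒜 with
  | zero => simp
  | @homogeneous i a =>
    induction b using DirectSum.Decomposition.inductionOn 𝒜 with
    | zero => simp
    | @homogeneous j b => exact Ideal.subset_span ⟨i, j, a, b, a.2, b.2, rfl⟩
    | add b b' hb hb' =>
      convert add_mem hb hb' using 1
      noncomm_ring
  | add a a' ha ha' =>
    convert add_mem ha ha' using 1
    noncomm_ring

/-- Let `R` act on `M` through a homomorphism to `H` whose image contains `k` and the squares of the
generators. Chains of primes in the support of `M` over `R` lift to chains of primes of `H`, by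
going up to the largest commutative quotient of `H / ann M`; the passage to this quotient only kills
nilpotent elements. -/
theorem supportDim_le_krullDim (hH : IsConnectedGradedCommutative 𝒜) {s : ℕ} {x : Fin s → H}
    (hx : Algebra.adjoin k (Set.range x) = ⊤) {R : Type w} [CommRing R] (φ : R →+* H)
    (hφk : ∀ c : k, ∃ p, φ p = algebraMap k H c) (hφx : ∀ l, ∃ p, φ p = x l ^ 2)
    {M : Type*} [AddCommGroup M] [Module H M] [Module R M] [Module.Finite R M]
    (hsmul : ∀ (p : R) (m : M), p • m = φ p • m) :
    Module.supportDim R M ≤ krullDim H M := by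
  let I := Module.annihilator H M
  let N := I ⊔ Ideal.span (homogeneousCommutators 𝒜)
  have hc : ∀ c ∈ homogeneousCommutators 𝒜, c ∈ Subring.center H := fun c hc =>
    (commutator_mem_center hH hc).1
  have hN : N.IsTwoSided := isTwoSided_sup inferInstance (isTwoSided_span_of_center hc)
  let _ : CommRing (H ⧸ N) :=
    { Ideal.Quotient.ring N with
      mul_comm := fun a b => by
        obtain ⟨a, rfl⟩ := Ideal.Quotient.mk_surjective a
        obtain ⟨b, rfl⟩ := Ideal.Quotient.mk_surjective b
        rw [← map_mul, ← map_mul, Ideal.Quotient.eq]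
        exact Submodule.mem_sup_right (mul_comm_mem_span_homogeneousCommutators a b) }
  let π : H →+* H ⧸ N := Ideal.Quotient.mk N
  let _ : Algebra R (H ⧸ N) := (π.comp φ).toAlgebra
  have hint : Algebra.IsIntegral R (H ⧸ N) := by
    refine ⟨fun q => ?_⟩
    obtain ⟨h, rfl⟩ := Ideal.Quotient.mk_surjective q
    have hh : h ∈ Algebra.adjoin k (Set.range x) := hx ▸ trivial
    induction hh using Algebra.adjoin_induction with
    | mem y hy =>
      obtain ⟨l, rfl⟩ := hy
      obtain ⟨p, hp⟩ := hφx l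
      refine IsIntegral.of_pow (n := 2) two_pos ?_
      have : (Ideal.Quotient.mk N (x l)) ^ 2 = algebraMap R (H ⧸ N) p := by
        rw [← map_pow, ← hp]
        rfl
      rw [this]
      exact isIntegral_algebraMap
    | algebraMap c =>
      obtain ⟨p, hp⟩ := hφk c
      rw [← hp]
      exact isIntegral_algebraMap (x := p)
    | add y z _ _ hy hz => exact hy.add hz
    | mul y z _ _ hy hz => exact hy.mul hz
  have hgu : Algebra.HasGoingUp R (H ⧸ N) := .of_isIntegral
  have hker : ∀ P : Ideal R, P.IsPrime → Module.annihilator R M ≤ P →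
      Ideal.comap (algebraMap R (H ⧸ N)) ⊥ ≤ P := by
    intro P hP hPM p hp
    have hp' : φ p ∈ N := Ideal.Quotient.eq_zero_iff_mem.1 hp
    obtain ⟨n, hn⟩ := exists_pow_mem_of_mem_sup_span (I := I) hc
      (fun c hc => (commutator_mem_center hH hc).2) hp'
    refine hP.mem_of_pow_mem n (hPM (Module.mem_annihilator.2 fun m => ?_))
    rw [hsmul, map_pow]
    exact Module.mem_annihilator.1 hn m
  let f : PrimeSpectrum (H ⧸ N) → {P : Ideal H // P.IsPrime ∧ Module.annihilator H M ≤ P} :=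
    fun Q => ⟨Ideal.comap π Q.asIdeal, Q.isPrime.comap π, fun a ha => by
      have : π a = 0 := Ideal.Quotient.eq_zero_iff_mem.2 (Submodule.mem_sup_left ha)
      rw [Ideal.mem_comap, this]
      exact zero_mem _⟩
  have hf : StrictMono f := by
    intro Q Q' h
    refine lt_of_le_not_ge (Ideal.comap_mono h.le) fun h' => h.not_ge fun q hq => ?_
    obtain ⟨q, rfl⟩ := Ideal.Quotient.mk_surjective q
    exact h' hq
  refine iSup_le fun p => ?_
  let l : LTSeries (PrimeSpectrum R) := p.map Subtype.val fun _ _ h => h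
  obtain ⟨Q, -, hQ, hQP⟩ := Ideal.exists_ideal_over_prime_of_isIntegral (S := H ⧸ N)
    l.head.asIdeal ⊥ (hker _ l.head.isPrime (Module.mem_support_iff_of_finite.1 p.head.2))
  have : Q.LiesOver l.head.asIdeal := ⟨hQP.symm⟩
  obtain ⟨L, hL, -⟩ := Ideal.exists_ltSeries_of_hasGoingUp l Q
  have h1 : (L.map f hf).length = p.length := hL
  rw [← h1]
  exact le_iSup (fun p : LTSeries {P : Ideal H // P.IsPrime ∧ Module.annihilator H M ≤ P} =>
    (p.length : WithBot ℕ∞)) (L.map f hf)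

end Commutators

/-! ### Modules of finite length -/

section FiniteLength

open DirectSum

variable {k : Type u} [Field k] {H : Type v} [Ring H] [Algebra k H]
variable {𝒜 : ℤ → Submodule k H} [GradedAlgebra 𝒜] {s : ℕ} {x : Fin s → H}
variable {M : Type w} [AddCommGroup M] [Module H M] {ℳ : ℤ → AddSubgroup M}

theorem length_le_sum_degree {e : Fin s → ℤ} (hpos : ∀ l, 0 < e l) (L : List (Fin s)) :
    (L.length : ℤ) ≤ (L.map e).sum := by
  induction L with
  | nil => simp
  | cons l L ih =>
    simp only [List.map_cons, List.sum_cons, List.length_cons]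
    push_cast
    linarith [hpos l]

/-- A quotient of a finitely generated graded module which is bounded above has finite length: it is
of finite dimension over `k`, as long words in the generators act as zero. -/
theorem isFiniteLength_of_bounded [DirectSum.Decomposition ℳ] [SetLike.GradedSMul 𝒜 ℳ]
    [Module.Finite H M] (hx : Algebra.adjoin k (Set.range x) = ⊤) {e : Fin s → ℤ}
    (he : ∀ l, x l ∈ 𝒜 (e l)) (hpos : ∀ l, 0 < e l) (N : Submodule H M) {B : ℤ}
    (hB : ∀ j, B < j → ∀ m ∈ ℳ j, m ∈ N) : IsFiniteLength H (M ⧸ N) := by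
  classical
  have h1 : ∀ m : M, ∃ n : ℕ, ∀ L : List (Fin s), n < L.length → (L.map x).prod • m ∈ N := by
    intro m
    induction m using DirectSum.Decomposition.inductionOn ℳ with
    | zero => exact ⟨0, by simp⟩
    | @homogeneous i m =>
      refine ⟨(B - i).toNat, fun L hL => ?_⟩
      refine hB ((L.map e).sum + i) ?_ _ (smul_mem_degree (word_mem_degree he L) m.2 rfl)
      have := length_le_sum_degree hpos L
      omega
    | add m m' h h' =>
      obtain ⟨n, hn⟩ := h
      obtain ⟨n', hn'⟩ := h'
      refine ⟨max n n', fun L hL => ?_⟩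
      rw [smul_add]
      exact add_mem (hn L ((le_max_left _ _).trans_lt hL)) (hn' L ((le_max_right _ _).trans_lt hL))
  choose n hn using h1
  let _ : Module k (M ⧸ N) := Module.compHom (M ⧸ N) (algebraMap k H)
  have : IsScalarTower k H (M ⧸ N) := ⟨fun c h q => by
    rw [Algebra.smul_def, mul_smul]
    rfl⟩
  obtain ⟨G, hG⟩ := Module.Finite.fg_top (R := H) (M := M)
  let F : Set (M ⧸ N) :=
    ⋃ g ∈ G, (fun L : List (Fin s) => (L.map x).prod • N.mkQ g) '' {L | L.length ≤ n g}
  have hF : F.Finite := G.finite_toSet.biUnion fun g _ => (List.finite_length_le _ _).image _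
  have hspan : Submodule.span k F = ⊤ := by
    rw [eq_top_iff]
    rintro q -
    obtain ⟨m, rfl⟩ := N.mkQ_surjective q
    suffices h : ∀ a : H, a • N.mkQ m ∈ Submodule.span k F by simpa using h 1
    have hm : m ∈ Submodule.span H (G : Set M) := hG ▸ trivial
    induction hm using Submodule.span_induction with
    | mem g hg =>
      intro a
      have ha := mem_span_word_range hx a
      induction ha using Submodule.span_induction with
      | mem b hb =>
        obtain ⟨L, rfl⟩ := hb
        by_cases hL : L.length ≤ n g
        · exact Submodule.subset_span (Set.mem_biUnion hg ⟨L, hL, rfl⟩)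
        · have : (L.map x).prod • N.mkQ g = 0 := by
            rw [← map_smul]
            exact (Submodule.Quotient.mk_eq_zero N).2 (hn g L (not_le.1 hL))
          simp only [this]
          exact zero_mem _
      | zero => rw [zero_smul]; exact zero_mem _
      | add b c _ _ hb hc => rw [add_smul]; exact add_mem hb hc
      | smul c b _ hb => rw [smul_assoc]; exact Submodule.smul_mem _ c hb
    | zero => intro a; rw [map_zero, smul_zero]; exact zero_mem _
    | add y z _ _ hy hz => intro a; rw [map_add, smul_add]; exact add_mem (hy a) (hz a)
    | smul b y _ hy => intro a; rw [map_smul, smul_smul]; exact hy _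
  have hfin : Module.Finite k (M ⧸ N) := ⟨⟨hF.toFinset, by simpa using hspan⟩⟩
  rw [isFiniteLength_iff_isNoetherian_isArtinian]
  exact ⟨isNoetherian_of_tower k inferInstance, isArtinian_of_tower k inferInstance⟩

end FiniteLength

/-! ### The polynomial ring acting through the squares of the generators -/

section Transfer

open DirectSum MvPolynomial

attribute [local instance] MvPolynomial.weightedGradedAlgebra

variable {k : Type u} [Field k] {H : Type v} [Ring H] [Algebra k H]
variable {𝒜 : ℤ → Submodule k H} [GradedAlgebra 𝒜] {s : ℕ} {x : Fin s → H}

/-- The homomorphism from a polynomial ring to `H` sending the variables to the squares of the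
generators. -/
noncomputable def squareMap (hH : IsConnectedGradedCommutative 𝒜) {e : Fin s → ℤ}
    (he : ∀ l, x l ∈ 𝒜 (e l)) : MvPolynomial (Fin s) k →ₐ[k] H :=
  (Subalgebra.center k H).val.comp
    (aeval fun l => (⟨x l ^ 2, sq_mem_center hH (he l)⟩ : Subalgebra.center k H))

variable (hH : IsConnectedGradedCommutative 𝒜) {e : Fin s → ℤ} (he : ∀ l, x l ∈ 𝒜 (e l))

theorem squareMap_X (l : Fin s) : squareMap hH he (X l) = x l ^ 2 := by
  simp [squareMap]

theorem mul_squareMap_comm (p : MvPolynomial (Fin s) k) (h : H) :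
    h * squareMap hH he p = squareMap hH he p * h :=
  Subring.mem_center_iff.1 (Subtype.prop (aeval (R := k)
    (fun l => (⟨x l ^ 2, sq_mem_center hH (he l)⟩ : Subalgebra.center k H)) p)) h

theorem squareMap_mem_degree {d : ℤ} {p : MvPolynomial (Fin s) k}
    (hp : p ∈ weightedHomogeneousSubmodule k (fun l => 2 * e l) d) : squareMap hH he p ∈ 𝒜 d := by
  have h1 := mem_span_words (k := k) adjoin_range_X (X_mem_degree (w := fun l => 2 * e l)) hp
  clear hp
  induction h1 using Submodule.span_induction with
  | mem p hp =>
    obtain ⟨L, rfl, rfl⟩ := hp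
    rw [map_list_prod, List.map_map]
    refine word_mem_degree (x := squareMap hH he ∘ X) (fun l => ?_) L
    rw [Function.comp_apply, squareMap_X]
    simpa using SetLike.pow_mem_graded 2 (he l)
  | zero => simp
  | add p q _ _ hp hq => rw [map_add]; exact add_mem hp hq
  | smul c p _ hp => rw [map_smul]; exact Submodule.smul_mem _ c hp

/-- `H` is generated, as a module over the polynomial ring acting through the squares of the
generators, by finitely many words. -/
theorem finite_squareMap (hx : Algebra.adjoin k (Set.range x) = ⊤)
    (hpos : ∀ l, 0 < e l) [Module (MvPolynomial (Fin s) k) H]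
    (hsmul : ∀ (p : MvPolynomial (Fin s) k) (h : H), p • h = squareMap hH he p * h) :
    Module.Finite (MvPolynomial (Fin s) k) H := by
  obtain ⟨D₀, hD₀⟩ := exists_eq_sum_mul_sq_pow hH hx he 1
  let F : Set H := (fun L : List (Fin s) => (L.map x).prod) '' {L | L.length ≤ D₀.toNat}
  have hF : F.Finite := (List.finite_length_le _ _).image _
  have hk : ∀ (c : k) (h : H), c • h = (C c : MvPolynomial (Fin s) k) • h := by
    intro c h
    rw [hsmul, ← MvPolynomial.algebraMap_eq, AlgHom.commutes, Algebra.smul_def]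
  have key : ∀ (n : ℕ) (D : ℤ), D < D₀.toNat + n → ∀ a ∈ 𝒜 D,
      a ∈ Submodule.span (MvPolynomial (Fin s) k) F := by
    intro n
    induction n with
    | zero =>
      intro D hD a ha
      have h1 := mem_span_words hx he ha
      clear ha
      induction h1 using Submodule.span_induction with
      | mem b hb =>
        obtain ⟨L, hL, rfl⟩ := hb
        have := length_le_sum_degree hpos L
        exact Submodule.subset_span ⟨L, by simp only [Set.mem_ofPred_eq]; omega, rfl⟩
      | zero => exact zero_mem _
      | add b c _ _ hb hc => exact add_mem hb hc
      | smul c b _ hb => rw [hk]; exact Submodule.smul_mem _ _ hb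
    | succ n ih =>
      intro D hD a ha
      by_cases hD' : D₀ ≤ D
      · obtain ⟨h, hh, rfl⟩ := hD₀ D hD' a ha
        refine sum_mem fun l _ => ?_
        have h1 : h l * (x l ^ 2) ^ 1 = (X l : MvPolynomial (Fin s) k) • h l := by
          rw [hsmul, ← mul_squareMap_comm, squareMap_X, pow_one]
        rw [h1]
        refine Submodule.smul_mem _ _ (ih _ ?_ _ (hh l))
        have := hpos l
        push_cast at hD ⊢
        omega
      · exact ih D (by have := Int.self_le_toNat D₀; omega) a ha
  refine ⟨⟨hF.toFinset, ?_⟩⟩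
  rw [hF.coe_toFinset, eq_top_iff]
  rintro a -
  induction a using DirectSum.Decomposition.inductionOn 𝒜 with
  | zero => exact zero_mem _
  | @homogeneous D a =>
    exact key (D - D₀.toNat + 1).toNat D (by omega) a a.2
  | add a b ha hb => exact add_mem ha hb

/-- For central elements, the submodules `(ζ₁, …, ζᵢ)M` over `H` and over the polynomial ring
agree. -/
theorem mem_prefixSubmodule_squareMap {M : Type w} [AddCommGroup M] [Module H M]
    [Module (MvPolynomial (Fin s) k) M]
    (hsmul : ∀ (p : MvPolynomial (Fin s) k) (m : M), p • m = squareMap hH he p • m) {r : ℕ}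
    (f : Fin r → MvPolynomial (Fin s) k) (i : ℕ) (y : M) :
    y ∈ prefixSubmodule M (fun j => squareMap hH he (f j)) i ↔ y ∈ prefixSubmodule M f i := by
  have hcomm : ∀ (h : H) (p : MvPolynomial (Fin s) k) (m : M), h • p • m = p • h • m := by
    intro h p m
    rw [hsmul, hsmul, smul_smul, smul_smul, mul_squareMap_comm]
  constructor
  · intro hy
    induction hy using Submodule.span_induction with
    | mem y hy =>
      obtain ⟨j, m, hj, rfl⟩ := hy
      exact Submodule.subset_span ⟨j, m, hj, (hsmul _ _).symm⟩
    | zero => exact zero_mem _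
    | add y z _ _ hy hz => exact add_mem hy hz
    | smul h y hy' hy =>
      clear hy'
      induction hy using Submodule.span_induction with
      | mem y hy =>
        obtain ⟨j, m, hj, rfl⟩ := hy
        exact Submodule.subset_span ⟨j, h • m, hj, hcomm _ _ _⟩
      | zero => rw [smul_zero]; exact zero_mem _
      | add y z _ _ hy hz => rw [smul_add]; exact add_mem hy hz
      | smul p y _ hy => rw [hcomm]; exact Submodule.smul_mem _ p hy
  · intro hy
    induction hy using Submodule.span_induction with
    | mem y hy =>
      obtain ⟨j, m, hj, rfl⟩ := hy
      exact Submodule.subset_span ⟨j, m, hj, hsmul _ _⟩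
    | zero => exact zero_mem _
    | add y z _ _ hy hz => exact add_mem hy hz
    | smul p y _ hy => rw [hsmul]; exact Submodule.smul_mem _ _ hy

end Transfer

/-! ### The invariants of local cohomology -/

section Invariants

variable {k : Type u} [Field k] {H : Type v} [Ring H] [Algebra k H]
variable {𝒜 : ℤ → Submodule k H} [GradedAlgebra 𝒜] {s : ℕ} {x : Fin s → H}
variable {M : Type w} [AddCommGroup M] [Module H M] {ℳ : ℤ → AddSubgroup M}
  [SetLike.GradedSMul 𝒜 ℳ]

theorem nontrivial_localCohomology_iff {i : ℕ} {n : ℤ} :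
    Nontrivial (LocalCohomology 𝒜 ℳ x i n) ↔ ¬ Vanishes 𝒜 ℳ x i n := by
  rw [← not_subsingleton_iff_nontrivial, not_iff_not, QuotientAddGroup.subsingleton_iff,
    AddSubgroup.addSubgroupOf_eq_top]
  rfl

theorem aInvariant_le_iff {i : ℕ} {d : ℤ} :
    aInvariant 𝒜 ℳ x i ≤ ((d : WithTop ℤ) : WithBot (WithTop ℤ)) ↔
      ∀ j, d < j → Vanishes 𝒜 ℳ x i j := by
  rw [aInvariant, sSup_le_iff]
  constructor
  · intro h j hj
    by_contra hV
    have := h _ ⟨j, nontrivial_localCohomology_iff.2 hV, rfl⟩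
    rw [WithBot.coe_le_coe, WithTop.coe_le_coe] at this
    omega
  · rintro h _ ⟨j, hj, rfl⟩
    rw [WithBot.coe_le_coe, WithTop.coe_le_coe]
    by_contra! hdj
    exact nontrivial_localCohomology_iff.1 hj (h j hdj)

theorem aInvariant_eq_bot {i : ℕ} (h : ∀ j, Vanishes 𝒜 ℳ x i j) : aInvariant 𝒜 ℳ x i = ⊥ := by
  rw [aInvariant, sSup_eq_bot]
  rintro _ ⟨j, hj, rfl⟩
  exact (nontrivial_localCohomology_iff.1 hj (h j)).elim

end Invariants

/-! ### Existence of filter-regular sequences -/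

section Main

open DirectSum MvPolynomial

attribute [local instance] MvPolynomial.weightedGradedAlgebra

variable {k : Type u} [Field k] {H : Type v} [Ring H] [Algebra k H]
variable {𝒜 : ℤ → Submodule k H} [GradedAlgebra 𝒜] {s : ℕ} {x : Fin s → H}
variable {M : Type w} [AddCommGroup M] [Module H M] [Module.Finite H M]

/-- A finitely generated graded module of Krull dimension `r` has a filter-regular sequence of
length `r`. -/
theorem exists_isFilterRegular (hH : IsConnectedGradedCommutative 𝒜)
    (hx : Algebra.adjoin k (Set.range x) = ⊤) {e : Fin s → ℤ} (he : ∀ l, x l ∈ 𝒜 (e l))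
    (hpos : ∀ l, 0 < e l) (ℳ : ℤ → AddSubgroup M) [DirectSum.Decomposition ℳ]
    [SetLike.GradedSMul 𝒜 ℳ] {r : ℕ} (hr : krullDim H M = r) :
    ∃ (ζ : Fin r → H) (n : Fin r → ℤ), IsFilterRegular 𝒜 ℳ ζ n := by
  let φ := squareMap hH he
  let _ : Module (MvPolynomial (Fin s) k) H := Module.compHom H φ.toRingHom
  let _ : Module (MvPolynomial (Fin s) k) M := Module.compHom M φ.toRingHom
  have hsmul : ∀ (p : MvPolynomial (Fin s) k) (m : M), p • m = φ p • m := fun _ _ => rfl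
  have : IsScalarTower (MvPolynomial (Fin s) k) H M := ⟨fun p h m => mul_smul (φ p) h m⟩
  have : Module.Finite (MvPolynomial (Fin s) k) H :=
    finite_squareMap hH he hx hpos fun _ _ => rfl
  have : Module.Finite (MvPolynomial (Fin s) k) M := Module.Finite.trans H M
  have : SetLike.GradedSMul (weightedHomogeneousSubmodule k fun l => 2 * e l) ℳ :=
    ⟨fun {_ _ p _} hp hm =>
      smul_mem_degree (𝒜 := 𝒜) (a := φ p) (squareMap_mem_degree hH he hp) hm rfl⟩
  have hdim : Module.supportDim (MvPolynomial (Fin s) k) M ≤ r := by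
    rw [← hr]
    exact supportDim_le_krullDim hH hx φ.toRingHom (fun c => ⟨C c, φ.commutes c⟩)
      (fun l => ⟨X l, squareMap_X hH he l⟩) hsmul
  obtain ⟨f, n, d, h⟩ := exists_isRegularOfType (w := fun l => 2 * e l)
    (fun l => by linarith [hpos l]) (fun l => even_two_mul _) r ℳ hdim
  have hmem := mem_prefixSubmodule_squareMap hH he hsmul f
  have hvan : ∀ j : ℤ, prefixSum n r + d (Fin.last r) < j → ∀ m ∈ ℳ j,
      m ∈ prefixSubmodule M (fun j => φ (f j)) r :=
    fun j hj m hm => (hmem r m).2 (h.vanishing j hj m hm)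
  have hd : ∀ i, d i ≤ ∑ i, |d i| := fun i => (le_abs_self _).trans
    (Finset.single_le_sum (f := fun i => |d i|) (fun _ _ => abs_nonneg _) (Finset.mem_univ i))
  -- A constant sequence is a type sequence.
  refine ⟨fun j => φ (f j), n, fun _ => ∑ i, |d i|, fun i => ⟨(sub_one_lt _).le, le_rfl⟩, ⟨h.pos,
    fun i => squareMap_mem_degree hH he (h.homogeneous i),
    isFiniteLength_of_bounded hx he hpos _ hvan⟩, fun i j hj m hm hm' => ?_, fun j hj => ?_⟩
  · exact (hmem i m).2 (h.injective i j (by linarith [hd i.castSucc]) m hm ((hmem i _).1 hm'))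
  · exact hvan j (by linarith [hd (Fin.last r)])

end Main

end GradedReg

theorem theorem4p5 {k : Type*} [Field k] {H : Type*} [Ring H] [Algebra k H]
    (𝒜 : ℤ → Submodule k H) [GradedAlgebra 𝒜]
    (hH : GradedReg.IsConnectedGradedCommutative 𝒜)
    {s : ℕ} (x : Fin s → H) (hx : GradedReg.IsHomogeneousGenerators 𝒜 x)
    {M : Type*} [AddCommGroup M] [Module H M] [Module.Finite H M]
    (ℳ : ℤ → AddSubgroup M) [DirectSum.Decomposition ℳ] [SetLike.GradedSMul 𝒜 ℳ]
    (r : ℕ) (hr : GradedReg.krullDim H M = r)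
    (d : Fin (r + 1) → ℤ) (hd : GradedReg.IsTypeSequence d) :
    List.TFAE
      [∃ (ζ : Fin r → H) (n : Fin r → ℤ), GradedReg.IsFilterRegularOfType 𝒜 ℳ ζ n d,
       ∀ (ζ : Fin r → H) (n : Fin r → ℤ), GradedReg.IsFilterRegular 𝒜 ℳ ζ n →
         GradedReg.IsFilterRegularOfType 𝒜 ℳ ζ n d,
       ∀ i : Fin (r + 1),
         GradedReg.aInvariant 𝒜 ℳ x i ≤ ((d i : WithTop ℤ) : WithBot (WithTop ℤ))] ∧
    ((∀ i : Fin (r + 1),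
        GradedReg.aInvariant 𝒜 ℳ x i ≤ ((d i : WithTop ℤ) : WithBot (WithTop ℤ))) →
      GradedReg.regularity 𝒜 ℳ x ≤
        (((Finset.univ.sup' Finset.univ_nonempty
          (fun i : Fin (r + 1) => d i + (i : ℤ)) : ℤ) : WithTop ℤ) : WithBot (WithTop ℤ))) := by
  choose e hpos he using hx.homogeneous
  have hx' := hx.adjoin_eq_top
  obtain ⟨ζ₀, n₀, hζ₀⟩ := GradedReg.exists_isFilterRegular hH hx' he hpos ℳ hr
  have h12 : ∀ (ζ : Fin r → H) (n : Fin r → ℤ),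
      (∀ i : Fin (r + 1),
        GradedReg.aInvariant 𝒜 ℳ x i ≤ ((d i : WithTop ℤ) : WithBot (WithTop ℤ))) →
      GradedReg.IsFilterRegular 𝒜 ℳ ζ n → GradedReg.IsFilterRegularOfType 𝒜 ℳ ζ n d := by
    rintro ζ n h ⟨d', -, hd'⟩
    have := hd'.isRegularOfType.of_vanishes hH he hpos hd
      fun i => GradedReg.aInvariant_le_iff.1 (h i)
    exact ⟨hd'.hsop, this.injective, this.vanishing⟩
  refine ⟨?_, fun h => iSup_le fun j => ?_⟩
  · tfae_have 1 → 3 := fun ⟨ζ, n, h⟩ i => GradedReg.aInvariant_le_iff.2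
      ((h.isRegularOfType.vanishes hH he hpos hx').1 i)
    tfae_have 3 → 2 := fun h ζ n => h12 ζ n h
    tfae_have 2 → 1 := fun h => ⟨ζ₀, n₀, h ζ₀ n₀ hζ₀⟩
    tfae_finish
  · by_cases hj : j < r + 1
    · refine (add_le_add_left (h ⟨j, hj⟩) _).trans ?_
      rw [← WithBot.coe_add, ← WithTop.coe_add, WithBot.coe_le_coe, WithTop.coe_le_coe]
      exact Finset.le_sup' (fun i : Fin (r + 1) => d i + (i : ℤ)) (Finset.mem_univ ⟨j, hj⟩)
    · -- Local cohomology vanishes beyond the length of a filter-regular sequence.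
      obtain ⟨d', -, hd'⟩ := hζ₀
      rw [GradedReg.aInvariant_eq_bot fun n =>
        (hd'.isRegularOfType.vanishes hH he hpos hx').2 j n (by omega), WithBot.bot_add]
      exact bot_le
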